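/- Let $p>1$ and let $g_p(t)=t^2\left(\log\frac1t\right)^p$. Denote by $\mathcal H^{g_p}$ the generalized Hausdorff measure on $\mathbb R^2$ with gauge $g_p$, that is, $\mathcal H^{g_p}(A)=\lim_{\delta\to0}\inf\left\{\sum_{i=1}^\infty g_p(\operatorname{diam}U_i): A\subset\bigcup_i U_i,\ \operatorname{diam}U_i\le\delta\right\}$ (only small $t$ matter, and $g_p(0)=0$). Call a map $\mathbb R^2\to\mathbb R^2$ locally Hölder continuous if there is an exponent $\gamma\in(0,1]$ such that it is $\gamma$-Hölder continuous on every compact set, with a constant that may depend on the set. There is a locally Hölder continuous homeomorphism $f:\mathbb R^2\to\mathbb R^2$ with $f\in W^{1,2}_{\mathrm{loc}}(\mathbb R^2,\mathbb R^2)$ such that $\mathcal H^{g_p}(f(S^1))>0$, where $S^1=\{x\in\mathbb R^2:|x|=1\}$. Moreover, $f$ can be taken of the form $f=h\circ g$, where - $g:\mathbb R^2\to\mathbb R^2$ is a locally Hölder continuous quasiconformal homeomorphism (there is a constant $H$ with $\limsup_{r\to0}\frac{\max_{|y-x|=r}|g(y)-g(x)|}{\min_{|z-x|=r}|g(z)-g(x)|}\le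 H$ for all $x$); - $h:\mathbb R^2\to\mathbb R^2$ is a locally Hölder continuous homeomorphism in $W^{1,2}_{\mathrm{loc}}(\mathbb R^2,\mathbb R^2)$ that is the identity outside $[0,1]^2$; - there is a Cantor set $\mathcal C\subset[0,1]^2$ (a set homeomorphic to $\{0,1\}^{\mathbb N}$) with $\mathcal C\subset g(S^1)$, $\mathcal H^{g_p}(\mathcal C)=0$ and $\mathcal H^{g_p}(h(\mathcal C))>0$. -/

import Mathlib

open MeasureTheory Filter Topology
open scoped NNReal ENNReal ContDiff

/-- `v` is the weak `i`-th partial derivative of `u` on the whole of `ℝⁿ`. Both functions are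
required to be locally integrable, so that the integrals below are genuine. -/
def HasWeakPartialDeriv {n : ℕ} (i : Fin n) (u v : EuclideanSpace ℝ (Fin n) → ℝ) : Prop :=
  LocallyIntegrable u ∧ LocallyIntegrable v ∧
    ∀ φ : EuclideanSpace ℝ (Fin n) → ℝ, ContDiff ℝ ∞ φ → HasCompactSupport φ →
      ∫ x, u x * fderiv ℝ φ x (EuclideanSpace.single i 1) = - ∫ x, v x * φ x

/-- `u ∈ L^q_loc(ℝⁿ)`. -/
def MemLpLoc {n : ℕ} (q : ℝ≥0∞) (u : EuclideanSpace ℝ (Fin n) → ℝ) : Prop :=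
  ∀ K : Set (EuclideanSpace ℝ (Fin n)), IsCompact K → MemLp u q (volume.restrict K)

/-- `f ∈ W^{1,q}_loc(ℝⁿ, ℝᵐ)`, for `q ≥ 1`: every component of `f` lies in `L^q_loc` and has weak
first order partial derivatives in `L^q_loc`. -/
def MemSobolevOneLoc {n m : ℕ} (q : ℝ≥0∞)
    (f : EuclideanSpace ℝ (Fin n) → EuclideanSpace ℝ (Fin m)) : Prop :=
  ∀ j : Fin m, MemLpLoc q (fun x => f x j) ∧
    ∀ i : Fin n, ∃ v : EuclideanSpace ℝ (Fin n) → ℝ,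
      MemLpLoc q v ∧ HasWeakPartialDeriv i (fun x => f x j) v

/-- Local Hölder continuity: for one exponent `γ ∈ (0, 1]`, the map is `γ`-Hölder continuous on
every compact set, with a constant that may depend on the compact set. -/
def LocallyHolder {X Y : Type*} [PseudoEMetricSpace X] [PseudoEMetricSpace Y]
    (f : X → Y) : Prop :=
  ∃ γ : ℝ≥0, 0 < γ ∧ γ ≤ 1 ∧ ∀ K : Set X, IsCompact K → ∃ C : ℝ≥0, HolderOnWith C γ f K

/-- The metric definition of quasiconformality of a homeomorphism `g` of `ℝⁿ`: the linear
dilatation `limsup_{r → 0} max_{|y-x|=r} |g y - g x| / min_{|z-x|=r} |g z - g x|` is bounded by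
a constant that does not depend on `x`. -/
def IsQuasiconformal {n : ℕ}
    (g : EuclideanSpace ℝ (Fin n) ≃ₜ EuclideanSpace ℝ (Fin n)) : Prop :=
  ∃ H : ℝ, ∀ x : EuclideanSpace ℝ (Fin n), ∀ᶠ r in 𝓝[>] (0 : ℝ),
    ∀ y z : EuclideanSpace ℝ (Fin n), dist y x = r → dist z x = r →
      dist (g y) (g x) ≤ H * dist (g z) (g x)

/-- A Cantor set: a subset homeomorphic to the Cantor space `{0,1}^ℕ`. -/
def IsCantorSet {X : Type*} [TopologicalSpace X] (C : Set X) : Prop :=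
  Nonempty (C ≃ₜ (ℕ → Bool))

/-- The gauge function `g(t) = t² (log (1/t))^p`. -/
noncomputable def logGauge (p t : ℝ) : ℝ := t ^ 2 * Real.log (1 / t) ^ p

/-- The generalized Hausdorff measure `H^g` for `g = logGauge p`. It is the supremum over `δ > 0`
of the infimum of `∑ g(diam Uᵢ)` over countable covers with `diam Uᵢ ≤ δ`, so that only the values
of `g(t)` for small `t > 0` (and `g(0) = 0`) matter. -/
noncomputable def logHausdorffMeasure {X : Type*} [EMetricSpace X] [MeasurableSpace X]
    [BorelSpace X] (p : ℝ) : Measure X :=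
  Measure.mkMetric fun d : ℝ≥0∞ => ENNReal.ofReal (logGauge p d.toReal)

/-! Start from the self-similar Cantor dust in the plane in which every square of side `s` contains
four squares of side `s / 8`. Generation `n` has `4 ^ n` squares of side comparable to `8⁻ⁿ`, so the
dust is negligible for the gauge and its neighbourhoods have area of order `16⁻ⁿ`. The map `h`
carries it onto a fat Cantor set with four children of ratio `μ k < 1 / 2` at generation `k`. It is
a limit of maps that, in each square, blow up the concentric small square linearly and absorb the
stretching in the surrounding frame by a radial, piecewise linear map.

Write `P n = ∏_{j<n} 2 μ j`. Near generation `n` the map is Lipschitz with constant of order `4 ^ n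
* P n`, on a set of area of order `16⁻ⁿ`, so the Dirichlet energy is controlled by `∑ (P n)²`. A
target square has diameter of order `2⁻ⁿ * P n` and carries natural mass `4⁻ⁿ`, while its gauge is
at least of order `4⁻ⁿ * (P n)² * n ^ p`. With `P n` of order `n ^ (-p / 2)` the gauge dominates the
mass, and the energy converges because `p > 1`. The mass distribution principle then gives positive
measure.

The dust is thin enough to project injectively, with Lipschitz inverse, onto a line of direction
`(1, 2)`. It therefore lies on a Lipschitz graph, and a bi-Lipschitz, hence quasiconformal, shear
`g` carries an arc of the circle onto a curve through it.

The key lemmas are `dist_approxMap_le` (Lipschitz growth),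
`exists_hasWeakPartialDeriv_of_stabilizing` (weak derivatives of the limit),
`logHausdorffMeasure_image_pos` (positive measure) and `exists_shear` (the circle). The
approximations peel off the outermost generation and shift `μ`, so the inductions run over all
admissible sequences at once. -/

/-! ### Gluing Lipschitz maps along spheres. -/

theorem exists_mem_segment_inter_sphere {V : Type*} [NormedAddCommGroup V] [NormedSpace ℝ V]
    {c x y : V} {r : ℝ} (hx : dist x c ≤ r) (hy : r ≤ dist y c) :
    ∃ z ∈ segment ℝ x y, dist z c = r := by
  have h := (convex_segment (𝕜 := ℝ) x y).isPreconnected.intermediate_value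
    (left_mem_segment ℝ x y) (right_mem_segment ℝ x y)
    (f := fun z => dist z c) (by fun_prop)
  obtain ⟨z, hz, hz'⟩ := h ⟨hx, hy⟩
  exact ⟨z, hz, hz'⟩

/-- A map that agrees with an `L`-Lipschitz map `e` outside closed balls, agrees with `e` on the
boundary spheres and is `L`-Lipschitz on each of the balls is `L`-Lipschitz. -/
theorem dist_le_of_glue_balls {V W : Type*} [NormedAddCommGroup V] [NormedSpace ℝ V]
    [PseudoMetricSpace W] {L : ℝ} {u e : V → W}
    (he : ∀ x y, dist (e x) (e y) ≤ L * dist x y)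
    (hu : ∀ x, u x = e x ∨ ∃ (c : V) (r : ℝ), dist x c ≤ r ∧
      (∀ y z, dist y c ≤ r → dist z c ≤ r → dist (u y) (u z) ≤ L * dist y z) ∧
      ∀ z, dist z c = r → u z = e z) (x y : V) :
    dist (u x) (u y) ≤ L * dist x y := by
  -- When one endpoint is governed by `e`, cut the segment where it crosses the sphere around the
  -- other. Distances add along a segment, so the constant is not lost.
  have key : ∀ x y, u x = e x → dist (u x) (u y) ≤ L * dist x y := by
    intro x y hx
    rcases hu y with hy | ⟨c, r, hyc, hl, hs⟩
    · rw [hx, hy]; exact he x y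
    · rcases le_total (dist x c) r with hxc | hxc
      · exact hl x y hxc hyc
      · obtain ⟨z, hz, hzr⟩ := exists_mem_segment_inter_sphere hyc hxc
        have h1 := hl z y hzr.le hyc
        have h2 := he x z
        rw [← hx, ← hs z hzr] at h2
        have h3 := dist_add_dist_of_mem_segment hz
        rw [dist_comm y z, dist_comm z x, dist_comm y x] at h3
        rw [← h3]
        linarith [dist_triangle (u x) (u z) (u y)]
  rcases hu x with hx | ⟨c, r, hxc, hl, hs⟩
  · exact key x y hx
  · rcases le_total (dist y c) r with hyc | hyc
    · exact hl x y hxc hyc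
    · obtain ⟨z, hz, hzr⟩ := exists_mem_segment_inter_sphere hxc hyc
      have h1 := hl x z hxc hzr.le
      have h2 := key z y (hs z hzr)
      rw [← dist_add_dist_of_mem_segment hz]
      linarith [dist_triangle (u x) (u z) (u y)]

/-! ### Radial maps of a normed space. -/

/-- The radial map with profile `θ`. -/
noncomputable def radialMap {V : Type*} [NormedAddCommGroup V] [NormedSpace ℝ V] (θ : ℝ → ℝ)
    (v : V) : V := (θ ‖v‖ / ‖v‖) • v

section radial
variable {V : Type*} [NormedAddCommGroup V] [NormedSpace ℝ V]

theorem radialMap_eq_smul {θ : ℝ → ℝ} {v : V} {a : ℝ} (h : θ ‖v‖ = a * ‖v‖) :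
    radialMap θ v = a • v := by
  rcases eq_or_ne v 0 with rfl | hv
  · simp [radialMap]
  · rw [radialMap, h, mul_div_cancel_right₀ _ (norm_ne_zero_iff.2 hv)]

theorem norm_radialMap {θ : ℝ → ℝ} (h0 : θ 0 = 0) (hθ : ∀ t, 0 ≤ t → 0 ≤ θ t) (v : V) :
    ‖radialMap θ v‖ = θ ‖v‖ := by
  rcases eq_or_ne v 0 with rfl | hv
  · simp [radialMap, h0]
  · have := norm_pos_iff.2 hv
    rw [radialMap, norm_smul, Real.norm_of_nonneg (div_nonneg (hθ _ this.le) this.le)]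
    field_simp

theorem radialMap_leftInverse {θ ζ : ℝ → ℝ} (h0 : θ 0 = 0) (hθ : ∀ t, 0 ≤ t → 0 ≤ θ t)
    (h : ∀ t, 0 ≤ t → ζ (θ t) = t) (v : V) : radialMap ζ (radialMap θ v) = v := by
  rcases eq_or_ne v 0 with rfl | hv
  · simp [radialMap]
  · have hv' := norm_pos_iff.2 hv
    have hne : θ ‖v‖ ≠ 0 := by
      intro h1
      have h2 := h _ hv'.le
      have h3 := h 0 le_rfl
      rw [h1] at h2; rw [h0] at h3
      linarith
    rw [radialMap, norm_radialMap h0 hθ, h _ hv'.le, radialMap, smul_smul]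
    rw [show ‖v‖ / θ ‖v‖ * (θ ‖v‖ / ‖v‖) = 1 by field_simp, one_smul]

/-- The difference splits into a change of profile along `v`, costing `L`, and the slope `θ ‖w‖ /
‖w‖`, at most `L`, times the difference between `w` and `v` rescaled to norm `‖w‖`, which is at most
`2 * ‖v - w‖`. -/
theorem dist_radialMap_le {θ : ℝ → ℝ} {L : ℝ} (h0 : θ 0 = 0)
    (hL : ∀ s t, |θ s - θ t| ≤ L * |s - t|) (v w : V) :
    dist (radialMap θ v) (radialMap θ w) ≤ 3 * L * dist v w := by
  have hL0 : 0 ≤ L := by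
    have := (abs_nonneg _).trans (hL 0 1)
    simpa using this
  wlog hle : ‖w‖ ≤ ‖v‖ generalizing v w
  · rw [dist_comm, dist_comm v]; exact this w v (le_of_not_ge hle)
  rcases eq_or_ne w 0 with rfl | hw
  · have h1 : radialMap θ (0 : V) = 0 := by simp [radialMap]
    rw [h1, dist_zero_right, dist_zero_right, radialMap, norm_smul, norm_div, norm_norm]
    have h2 := hL ‖v‖ 0
    rw [h0, sub_zero, sub_zero, abs_of_nonneg (norm_nonneg v)] at h2
    calc ‖θ ‖v‖‖ / ‖v‖ * ‖v‖ ≤ |θ ‖v‖| := by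
          rw [Real.norm_eq_abs]
          rcases (norm_nonneg v).eq_or_lt with h | h
          · simp [← h]
          · field_simp
            exact le_rfl
      _ ≤ L * ‖v‖ := h2
      _ ≤ 3 * L * ‖v‖ := by nlinarith [mul_nonneg hL0 (norm_nonneg v)]
  have hw' := norm_pos_iff.2 hw
  have hv' : 0 < ‖v‖ := hw'.trans_le hle
  rw [dist_eq_norm, dist_eq_norm]
  have e1 : radialMap θ v - radialMap θ w = (((θ ‖v‖ - θ ‖w‖) / ‖v‖) • v)
      + (θ ‖w‖ / ‖w‖) • (((‖w‖ - ‖v‖) / ‖v‖) • v + (v - w)) := by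
    have : (θ ‖w‖ / ‖w‖) • (((‖w‖ - ‖v‖) / ‖v‖) • v + (v - w))
        = (θ ‖w‖ / ‖v‖) • v - (θ ‖w‖ / ‖w‖) • w := by
      rw [← add_sub_assoc, smul_sub, smul_add, smul_smul, ← add_smul]
      congr 2
      field_simp
      ring
    rw [this, radialMap, radialMap, sub_div, sub_smul]
    abel
  have hnn : |‖v‖ - ‖w‖| ≤ ‖v - w‖ := abs_norm_sub_norm_le v w
  have unit : ∀ a : ℝ, ‖(a / ‖v‖) • v‖ = |a| := by
    intro a
    rw [norm_smul, norm_div, norm_norm, Real.norm_eq_abs]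
    field_simp
  have h1 : ‖((θ ‖v‖ - θ ‖w‖) / ‖v‖) • v‖ ≤ L * ‖v - w‖ := by
    rw [unit]
    exact (hL _ _).trans (by gcongr)
  have h2 : ‖((‖w‖ - ‖v‖) / ‖v‖) • v + (v - w)‖ ≤ 2 * ‖v - w‖ := by
    refine (norm_add_le _ _).trans ?_
    rw [unit, abs_sub_comm]
    linarith
  have h3 : |θ ‖w‖ / ‖w‖| ≤ L := by
    have h2 := hL ‖w‖ 0
    rw [h0, sub_zero, sub_zero, abs_of_nonneg (norm_nonneg w)] at h2
    rw [abs_div, abs_of_pos hw']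
    exact (div_le_iff₀ hw').2 h2
  rw [e1]
  refine (norm_add_le _ _).trans ?_
  rw [norm_smul (θ ‖w‖ / ‖w‖), Real.norm_eq_abs]
  have := mul_le_mul h3 h2 (norm_nonneg _) hL0
  linarith

end radial

/-! ### The stretching profile and its inverse. -/

/-- The piecewise linear profile that maps `1/8` to `m` and is the identity from `1/2` on. -/
noncomputable def stretchProfile (m t : ℝ) : ℝ :=
  max t (min (8 * m * t) (1 / 2 + (8 * (1 / 2 - m) / 3) * (t - 1 / 2)))

/-- The inverse of `stretchProfile m`. -/
noncomputable def squeezeProfile (m t : ℝ) : ℝ :=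
  min t (max (t / (8 * m)) (1 / 2 + (t - 1 / 2) / (8 * (1 / 2 - m) / 3)))

section profile
variable {m : ℝ}

theorem stretchProfile_zero : stretchProfile m 0 = 0 := by
  rw [stretchProfile, max_eq_left]
  refine (min_le_left _ _).trans (by simp)

theorem squeezeProfile_zero : squeezeProfile m 0 = 0 := by
  rw [squeezeProfile, min_eq_left]
  refine le_trans ?_ (le_max_left _ _)
  simp

theorem stretchProfile_nonneg {t : ℝ} (ht : 0 ≤ t) : 0 ≤ stretchProfile m t :=
  ht.trans (le_max_left _ _)

theorem squeezeProfile_nonneg (h1 : 1 / 4 ≤ m) {t : ℝ} (ht : 0 ≤ t) : 0 ≤ squeezeProfile m t :=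
  le_min ht ((div_nonneg ht (by linarith)).trans (le_max_left _ _))

theorem stretchProfile_of_le (h1 : 1 / 4 ≤ m) {t : ℝ} (h0 : 0 ≤ t)
    (ht : t ≤ 1 / 8) : stretchProfile m t = 8 * m * t := by
  rw [stretchProfile, min_eq_left (by nlinarith), max_eq_right (by nlinarith)]

theorem stretchProfile_of_ge (h1 : 1 / 4 ≤ m) {t : ℝ}
    (ht : 1 / 2 ≤ t) : stretchProfile m t = t := by
  rw [stretchProfile, max_eq_left]
  exact (min_le_right _ _).trans (by nlinarith)

/-- Inverting increasing functions exchanges `max` and `min` and inverts each affine piece, so the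
identity reduces to inequalities between the pieces. -/
theorem squeezeProfile_stretchProfile (h1 : 1 / 4 ≤ m) (h2 : m < 1 / 2) (t : ℝ) :
    squeezeProfile m (stretchProfile m t) = t := by
  have hs : 0 < 8 * (1 / 2 - m) / 3 := by linarith
  have hm : 0 < 8 * m := by linarith
  unfold squeezeProfile stretchProfile
  set s := 8 * (1 / 2 - m) / 3
  set S := 8 * m
  apply le_antisymm
  · rcases le_total (min (S * t) (1 / 2 + s * (t - 1 / 2))) t with h | h
    · rw [max_eq_left h]; exact min_le_left _ _
    · rw [max_eq_right h]
      refine (min_le_right _ _).trans (max_le ?_ ?_)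
      · rw [div_le_iff₀ hm]; exact (min_le_left _ _).trans (by rw [mul_comm])
      · have := min_le_right (S * t) (1 / 2 + s * (t - 1 / 2))
        have : (min (S * t) (1 / 2 + s * (t - 1 / 2)) - 1 / 2) / s ≤ t - 1 / 2 := by
          rw [div_le_iff₀ hs]; linarith
        linarith
  · refine le_min (le_max_left _ _) ?_
    have h := le_max_right t (min (S * t) (1 / 2 + s * (t - 1 / 2)))
    rcases min_le_iff.1 h with h | h
    · exact le_max_of_le_left (by rw [le_div_iff₀ hm]; linarith)
    · refine le_max_of_le_right ?_
      have : t - 1 / 2 ≤ (max t (min (S * t) (1 / 2 + s * (t - 1 / 2))) - 1 / 2) / s := by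
        rw [le_div_iff₀ hs]; linarith
      linarith

theorem stretchProfile_squeezeProfile (h1 : 1 / 4 ≤ m) (h2 : m < 1 / 2) (t : ℝ) :
    stretchProfile m (squeezeProfile m t) = t := by
  have hs : 0 < 8 * (1 / 2 - m) / 3 := by linarith
  have hm : 0 < 8 * m := by linarith
  unfold squeezeProfile stretchProfile
  set s := 8 * (1 / 2 - m) / 3
  set S := 8 * m
  have hd : ∀ x : ℝ, s * (x / s) = x := fun x => by field_simp
  have hd' : ∀ x : ℝ, S * (x / S) = x := fun x => by field_simp
  apply le_antisymm
  · refine max_le (min_le_left _ _) ?_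
    have h := min_le_right t (max (t / S) (1 / 2 + (t - 1 / 2) / s))
    rcases le_max_iff.1 h with h | h
    · exact min_le_of_left_le ((mul_le_mul_of_nonneg_left h hm.le).trans (hd' t).le)
    · refine min_le_of_right_le ?_
      have := mul_le_mul_of_nonneg_left (sub_le_sub_right h (1 / 2)) hs.le
      rw [add_sub_cancel_left, hd] at this
      linarith
  · rcases le_total t (max (t / S) (1 / 2 + (t - 1 / 2) / s)) with h | h
    · rw [min_eq_left h]; exact le_max_left _ _
    · rw [min_eq_right h]
      refine le_max_of_le_right (le_min ?_ ?_)
      · exact (hd' t).ge.trans (mul_le_mul_of_nonneg_left (le_max_left _ _) hm.le)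
      · have := mul_le_mul_of_nonneg_left
          (sub_le_sub_right (le_max_right (t / S) (1 / 2 + (t - 1 / 2) / s)) (1 / 2)) hs.le
        rw [add_sub_cancel_left, hd] at this
        linarith

theorem abs_max_sub_max_le {a b c d r : ℝ} (h1 : |a - c| ≤ r) (h2 : |b - d| ≤ r) :
    |max a b - max c d| ≤ r :=
  (abs_max_sub_max_le_max a b c d).trans (max_le h1 h2)

theorem abs_min_sub_min_le {a b c d r : ℝ} (h1 : |a - c| ≤ r) (h2 : |b - d| ≤ r) :
    |min a b - min c d| ≤ r :=
  (abs_min_sub_min_le_max a b c d).trans (max_le h1 h2)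

/-- The three slopes are `1`, `8 * m < 4` and `8 * (1 / 2 - m) / 3 < 1`, so the bound is uniform in
`m`. For the inverse it degenerates as `m` tends to `1 / 2`. -/
theorem abs_stretchProfile_sub_le (h1 : 1 / 4 ≤ m) (h2 : m < 1 / 2) (s t : ℝ) :
    |stretchProfile m s - stretchProfile m t| ≤ 4 * |s - t| := by
  have h := abs_nonneg (s - t)
  refine abs_max_sub_max_le (by linarith) (abs_min_sub_min_le ?_ ?_)
  · rw [← mul_sub, abs_mul, abs_of_nonneg (by linarith)]
    nlinarith
  · rw [add_sub_add_left_eq_sub, ← mul_sub, sub_sub_sub_cancel_right, abs_mul,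
      abs_of_nonneg (by linarith)]
    nlinarith

theorem exists_abs_squeezeProfile_sub_le (h1 : 1 / 4 ≤ m) (h2 : m < 1 / 2) :
    ∃ L, ∀ s t : ℝ, |squeezeProfile m s - squeezeProfile m t| ≤ L * |s - t| := by
  have hs : 0 < 8 * (1 / 2 - m) / 3 := by linarith
  have hi := inv_pos.2 hs
  refine ⟨1 + (8 * (1 / 2 - m) / 3)⁻¹, fun s t => ?_⟩
  have h := abs_nonneg (s - t)
  refine abs_min_sub_min_le (by nlinarith) (abs_max_sub_max_le ?_ ?_)
  · rw [← sub_div, abs_div, abs_of_nonneg (by linarith : 0 ≤ 8 * m)]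
    refine (div_le_self h (by linarith)).trans (by nlinarith)
  · rw [add_sub_add_left_eq_sub, ← sub_div, sub_sub_sub_cancel_right, abs_div,
      abs_of_pos hs, div_eq_inv_mul]
    nlinarith

end profile

/-! ### Planting copies of a map in the four quadrants. -/

/-- The plane with the supremum norm. -/
abbrev SupPlane := Fin 2 → ℝ

/-- `1/2` or `-1/2`. -/
noncomputable def halfSign (b : Bool) : ℝ := if b then 1 / 2 else -1 / 2

/-- The centres of the four quadrants of the unit ball of `SupPlane`. -/
noncomputable def corner (b : Fin 2 → Bool) : SupPlane := fun i => halfSign (b i)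

/-- The quadrant of `x`. -/
noncomputable def quadrant (x : SupPlane) : Fin 2 → Bool := fun i => decide (0 ≤ x i)

/-- A copy of `W` in each of the four quadrants of the unit ball. -/
noncomputable def plant (W : SupPlane → SupPlane) (x : SupPlane) : SupPlane :=
  corner (quadrant x) + W (x - corner (quadrant x))

theorem abs_halfSign (b : Bool) : |halfSign b| = 1 / 2 := by
  cases b <;> norm_num [halfSign, abs_of_neg]

theorem norm_corner_le (b : Fin 2 → Bool) : ‖corner b‖ ≤ 1 / 2 := by
  rw [pi_norm_le_iff_of_nonneg (by norm_num)]
  intro i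
  exact (abs_halfSign (b i)).le

theorem quadrant_eq {x : SupPlane} {b : Fin 2 → Bool} (h : ‖x - corner b‖ < 1 / 2) :
    quadrant x = b := by
  rw [pi_norm_lt_iff (by norm_num)] at h
  ext i
  have hi := abs_lt.1 (h i)
  rw [Pi.sub_apply, corner, halfSign] at hi
  cases hb : b i
  · simp [hb] at hi
    simp only [quadrant, decide_eq_false_iff_not, not_le]; linarith
  · simp [hb] at hi
    simp only [quadrant, decide_eq_true_eq]; linarith

theorem norm_corner_add_le {b : Fin 2 → Bool} {w : SupPlane} (h : ‖w‖ ≤ 1 / 2) :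
    ‖corner b + w‖ ≤ 1 := by
  linarith [norm_add_le (corner b) w, norm_corner_le b]

theorem le_norm_sub_corner {x : SupPlane} (hx : 1 ≤ ‖x‖) (b : Fin 2 → Bool) :
    1 / 2 ≤ ‖x - corner b‖ := by
  linarith [norm_sub_norm_le x (corner b), norm_corner_le b]

theorem norm_sub_corner_quadrant_le {x : SupPlane} (hx : ‖x‖ ≤ 1) :
    ‖x - corner (quadrant x)‖ ≤ 1 / 2 := by
  rw [pi_norm_le_iff_of_nonneg (by norm_num)] at hx ⊢
  intro i
  have hi := abs_le.1 (hx i)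
  rw [Pi.sub_apply, corner, halfSign, quadrant, Real.norm_eq_abs, abs_le]
  by_cases h : 0 ≤ x i
  · simp only [h, decide_true, if_true]; constructor <;> linarith
  · simp only [h, decide_false, Bool.false_eq_true, if_false]
    push Not at h
    constructor <;> linarith

section plant
variable {W W' : SupPlane → SupPlane}

theorem plant_eq_self {x : SupPlane} (hW : ∀ v, 1 / 2 ≤ ‖v‖ → W v = v)
    (hx : ∀ b, 1 / 2 ≤ ‖x - corner b‖) : plant W x = x := by
  rw [plant, hW _ (hx _)]; abel

theorem plant_of_one_le {x : SupPlane} (hW : ∀ v, 1 / 2 ≤ ‖v‖ → W v = v)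
    (hx : 1 ≤ ‖x‖) : plant W x = x := plant_eq_self hW (le_norm_sub_corner hx)

/-- The rule choosing a quadrant is ambiguous only on the boundary of the small squares, where every
copy of `W` is the identity. -/
theorem plant_corner_add (hW : ∀ v, 1 / 2 ≤ ‖v‖ → W v = v) {b : Fin 2 → Bool} {v : SupPlane}
    (hv : ‖v‖ ≤ 1 / 2) : plant W (corner b + v) = corner b + W v := by
  rcases hv.lt_or_eq with hv | hv
  · have hq : quadrant (corner b + v) = b := quadrant_eq (by simpa using hv)
    rw [plant, hq, add_sub_cancel_left]
  · rw [hW v hv.ge]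
    by_cases h : ∀ b', 1 / 2 ≤ ‖corner b + v - corner b'‖
    · exact plant_eq_self hW h
    · push Not at h
      obtain ⟨b', hb'⟩ := h
      have hq := quadrant_eq hb'
      rw [plant, hq]
      rcases eq_or_ne b b' with rfl | hne
      · rw [add_sub_cancel_left, hW v hv.ge]
      · exfalso
        obtain ⟨i, hi⟩ := Function.ne_iff.1 hne
        rw [pi_norm_lt_iff (by norm_num)] at hb'
        have h1 := abs_lt.1 (hb' i)
        have h2 := abs_le.1 ((norm_le_pi_norm v i).trans hv.le)
        rw [Pi.sub_apply, Pi.add_apply, corner, corner, halfSign, halfSign] at h1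
        cases h3 : b i <;> cases h4 : b' i <;> simp [h3, h4] at hi h1 <;> linarith

theorem norm_plant_le (hW : ∀ v, ‖v‖ ≤ 1 / 2 → ‖W v‖ ≤ 1 / 2) {x : SupPlane} (hx : ‖x‖ ≤ 1) :
    ‖plant W x‖ ≤ 1 := norm_corner_add_le (hW _ (norm_sub_corner_quadrant_le hx))

theorem norm_plant_sub_plant_le {r : ℝ} (h : ∀ v, ‖W v - W' v‖ ≤ r) (x : SupPlane) :
    ‖plant W x - plant W' x‖ ≤ r := by
  rw [plant, plant, add_sub_add_left_eq_sub]
  exact h _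

theorem plant_leftInverse (hW : ∀ v, 1 / 2 ≤ ‖v‖ → W v = v)
    (hW' : ∀ v, 1 / 2 ≤ ‖v‖ → W' v = v) (hWb : ∀ v, ‖v‖ ≤ 1 / 2 → ‖W v‖ ≤ 1 / 2)
    (h : ∀ v, W' (W v) = v) (x : SupPlane) : plant W' (plant W x) = x := by
  rcases le_total ‖x‖ 1 with hx | hx
  · have := plant_corner_add hW' (b := quadrant x) (hWb _ (norm_sub_corner_quadrant_le hx))
    rw [h, add_sub_cancel] at this
    exact this
  · rw [plant_of_one_le hW hx, plant_of_one_le hW' hx]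

theorem dist_plant_le (hW : ∀ v, 1 / 2 ≤ ‖v‖ → W v = v) {L : ℝ} (hL : 1 ≤ L)
    (h : ∀ v w, dist (W v) (W w) ≤ L * dist v w) (x y : SupPlane) :
    dist (plant W x) (plant W y) ≤ L * dist x y := by
  refine dist_le_of_glue_balls (u := plant W) (e := id)
    (fun x y => le_mul_of_one_le_left dist_nonneg hL) (fun x => ?_) x y
  by_cases hx : ∀ b, 1 / 2 ≤ ‖x - corner b‖
  · exact Or.inl (plant_eq_self hW hx)
  · push Not at hx
    obtain ⟨b, hb⟩ := hx
    have key : ∀ y, dist y (corner b) ≤ 1 / 2 → plant W y = corner b + W (y - corner b) := by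
      intro y hy
      rw [← plant_corner_add hW (by rwa [← dist_eq_norm]), add_sub_cancel]
    refine Or.inr ⟨corner b, 1 / 2, by rw [dist_eq_norm]; exact hb.le, ?_, ?_⟩
    · intro y z hy hz
      rw [key y hy, key z hz, dist_add_left]
      simpa using h (y - corner b) (z - corner b)
    · intro z hz
      rw [key z hz.le, hW _ (by rw [← dist_eq_norm, hz])]
      simp

end plant

/-! ### Rescaled copies and the radial stretch. -/

/-- Conjugation of `u` by the homothety of ratio `1/8`. -/
noncomputable def shrinkConj (u : SupPlane → SupPlane) (v : SupPlane) : SupPlane :=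
  (1 / 8 : ℝ) • u ((8 : ℝ) • v)

/-- `u` is the identity outside the unit ball and preserves the unit ball. -/
structure UnitBallMap (u : SupPlane → SupPlane) : Prop where
  eq_self : ∀ v, 1 ≤ ‖v‖ → u v = v
  norm_le : ∀ v, ‖v‖ ≤ 1 → ‖u v‖ ≤ 1

section shrinkConj
variable {u u' : SupPlane → SupPlane}

theorem norm_eight_smul (v : SupPlane) : ‖(8 : ℝ) • v‖ = 8 * ‖v‖ := by
  rw [norm_smul]; norm_num

theorem norm_eighth_smul (v : SupPlane) : ‖(1 / 8 : ℝ) • v‖ = ‖v‖ / 8 := by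
  rw [norm_smul]; norm_num; ring

theorem shrinkConj_of_le (hu : UnitBallMap u) {v : SupPlane} (hv : 1 / 8 ≤ ‖v‖) :
    shrinkConj u v = v := by
  rw [shrinkConj, hu.eq_self _ (by rw [norm_eight_smul]; linarith), smul_smul]
  norm_num

theorem norm_shrinkConj_le (hu : UnitBallMap u) {v : SupPlane} (hv : ‖v‖ ≤ 1 / 8) :
    ‖shrinkConj u v‖ ≤ 1 / 8 := by
  have := hu.norm_le ((8 : ℝ) • v) (by rw [norm_eight_smul]; linarith)
  rw [shrinkConj, norm_eighth_smul]
  linarith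

theorem norm_shrinkConj_le_half (hu : UnitBallMap u) {v : SupPlane} (hv : ‖v‖ ≤ 1 / 2) :
    ‖shrinkConj u v‖ ≤ 1 / 2 := by
  rcases le_total ‖v‖ (1 / 8) with h | h
  · linarith [norm_shrinkConj_le hu h]
  · rwa [shrinkConj_of_le hu h]

theorem norm_shrinkConj_sub_le {r : ℝ} (h : ∀ v, ‖u v - u' v‖ ≤ r) (v : SupPlane) :
    ‖shrinkConj u v - shrinkConj u' v‖ ≤ r / 8 := by
  rw [shrinkConj, shrinkConj, ← smul_sub, norm_eighth_smul]
  linarith [h ((8 : ℝ) • v)]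

theorem shrinkConj_leftInverse (h : ∀ v, u' (u v) = v) (v : SupPlane) :
    shrinkConj u' (shrinkConj u v) = v := by
  rw [shrinkConj, shrinkConj, smul_smul]
  norm_num [h, smul_smul]

theorem dist_shrinkConj_le {L : ℝ} (h : ∀ x y, dist (u x) (u y) ≤ L * dist x y)
    (v w : SupPlane) : dist (shrinkConj u v) (shrinkConj u w) ≤ L * dist v w := by
  have := h ((8 : ℝ) • v) ((8 : ℝ) • w)
  rw [dist_eq_norm, dist_eq_norm, ← smul_sub, norm_eight_smul] at this
  rw [shrinkConj, shrinkConj, dist_eq_norm, dist_eq_norm, ← smul_sub, norm_eighth_smul]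
  linarith

end shrinkConj

section stretch
variable {m : ℝ} {u u' : SupPlane → SupPlane}

/-- The radial map of `SupPlane` with profile `stretchProfile m`. -/
noncomputable def stretch (m : ℝ) : SupPlane → SupPlane := radialMap (stretchProfile m)

/-- The radial map of `SupPlane` with profile `squeezeProfile m`. -/
noncomputable def squeeze (m : ℝ) : SupPlane → SupPlane := radialMap (squeezeProfile m)

theorem stretch_of_le (h1 : 1 / 4 ≤ m) {v : SupPlane} (hv : ‖v‖ ≤ 1 / 8) :
    stretch m v = (8 * m) • v :=
  radialMap_eq_smul (stretchProfile_of_le h1 (norm_nonneg v) hv)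

theorem stretch_of_ge (h1 : 1 / 4 ≤ m) {v : SupPlane} (hv : 1 / 2 ≤ ‖v‖) :
    stretch m v = v := by
  rw [stretch, radialMap_eq_smul (a := 1) (by rw [stretchProfile_of_ge h1 hv, one_mul]),
    one_smul]

theorem squeeze_stretch (h1 : 1 / 4 ≤ m) (h2 : m < 1 / 2) (v : SupPlane) :
    squeeze m (stretch m v) = v :=
  radialMap_leftInverse stretchProfile_zero (fun _ => stretchProfile_nonneg)
    (fun t _ => squeezeProfile_stretchProfile h1 h2 t) v

theorem stretch_squeeze (h1 : 1 / 4 ≤ m) (h2 : m < 1 / 2) (v : SupPlane) :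
    stretch m (squeeze m v) = v :=
  radialMap_leftInverse squeezeProfile_zero (fun _ => squeezeProfile_nonneg h1)
    (fun t _ => stretchProfile_squeezeProfile h1 h2 t) v

theorem squeeze_of_ge (h1 : 1 / 4 ≤ m) (h2 : m < 1 / 2) {v : SupPlane} (hv : 1 / 2 ≤ ‖v‖) :
    squeeze m v = v := by
  conv_lhs => rw [← stretch_of_ge h1 hv]
  exact squeeze_stretch h1 h2 v

theorem norm_squeeze_le (h1 : 1 / 4 ≤ m) (v : SupPlane) : ‖squeeze m v‖ ≤ ‖v‖ := by
  rw [squeeze, norm_radialMap squeezeProfile_zero (fun _ => squeezeProfile_nonneg h1)]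
  exact min_le_left _ _

theorem norm_stretch_le (h1 : 1 / 4 ≤ m) (h2 : m < 1 / 2) {v : SupPlane} (hv : ‖v‖ ≤ 1 / 2) :
    ‖stretch m v‖ ≤ 1 / 2 := by
  by_contra h
  push Not at h
  have h3 := squeeze_of_ge h1 h2 h.le
  rw [squeeze_stretch h1 h2] at h3
  rw [← h3] at h
  linarith

theorem dist_stretch_le (h1 : 1 / 4 ≤ m) (h2 : m < 1 / 2) (v w : SupPlane) :
    dist (stretch m v) (stretch m w) ≤ 12 * dist v w := by
  have := dist_radialMap_le stretchProfile_zero (abs_stretchProfile_sub_le h1 h2) v w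
  norm_num at this
  exact this

theorem exists_dist_squeeze_le (h1 : 1 / 4 ≤ m) (h2 : m < 1 / 2) :
    ∃ L, ∀ v w, dist (squeeze m v) (squeeze m w) ≤ L * dist v w := by
  obtain ⟨L, hL⟩ := exists_abs_squeezeProfile_sub_le h1 h2
  exact ⟨_, dist_radialMap_le squeezeProfile_zero hL⟩

/-- `u` on the ball of radius `1/8`, blown up to the ball of radius `m`. -/
theorem stretch_shrinkConj_of_le (h1 : 1 / 4 ≤ m) (hu : UnitBallMap u) {v : SupPlane}
    (hv : ‖v‖ ≤ 1 / 8) : stretch m (shrinkConj u v) = m • u ((8 : ℝ) • v) := by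
  rw [stretch_of_le h1 (norm_shrinkConj_le hu hv), shrinkConj, smul_smul]
  congr 1; ring

/-- The copies of `u` and `u'` are scaled by `m < 1 / 2` and agree elsewhere. This contraction makes
the approximations converge geometrically. -/
theorem norm_stretch_shrinkConj_sub_le (h1 : 1 / 4 ≤ m) (h2 : m < 1 / 2) (hu : UnitBallMap u)
    (hu' : UnitBallMap u') {r : ℝ} (h : ∀ v, ‖u v - u' v‖ ≤ r) (v : SupPlane) :
    ‖stretch m (shrinkConj u v) - stretch m (shrinkConj u' v)‖ ≤ r / 2 := by
  have hr := (norm_nonneg _).trans (h 0)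
  rcases le_total ‖v‖ (1 / 8) with hv | hv
  · rw [stretch_shrinkConj_of_le h1 hu hv, stretch_shrinkConj_of_le h1 hu' hv, ← smul_sub,
      norm_smul, Real.norm_of_nonneg (by linarith)]
    have := h ((8 : ℝ) • v)
    nlinarith [norm_nonneg (u ((8 : ℝ) • v) - u' ((8 : ℝ) • v))]
  · rw [shrinkConj_of_le hu hv, shrinkConj_of_le hu' hv, sub_self, norm_zero]
    linarith

/-- On the ball of radius `1 / 8`, where the copy of `u` lives, the stretch is linear with factor `8
* m`; outside, only the stretch acts, with constant `12`. Gluing gives the maximum of the two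
regimes, so the factor `12` is not compounded over generations. -/
theorem dist_stretch_shrinkConj_le (h1 : 1 / 4 ≤ m) (h2 : m < 1 / 2) (hu : UnitBallMap u)
    {L : ℝ} (hL : 12 ≤ L) (h : ∀ x y, 8 * m * dist (u x) (u y) ≤ L * dist x y) (v w : SupPlane) :
    dist (stretch m (shrinkConj u v)) (stretch m (shrinkConj u w)) ≤ L * dist v w := by
  refine dist_le_of_glue_balls (u := fun v => stretch m (shrinkConj u v)) (e := stretch m)
    (fun x y => (dist_stretch_le h1 h2 x y).trans (by gcongr)) (fun x => ?_) v w
  rcases le_total (1 / 8) ‖x‖ with hx | hx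
  · left; rw [shrinkConj_of_le hu hx]
  · refine Or.inr ⟨0, 1 / 8, by simpa using hx, ?_, ?_⟩
    · intro y z hy hz
      rw [dist_zero_right] at hy hz
      simp only [stretch_shrinkConj_of_le h1 hu hy, stretch_shrinkConj_of_le h1 hu hz]
      have := h ((8 : ℝ) • y) ((8 : ℝ) • z)
      rw [dist_smul₀, Real.norm_of_nonneg (by linarith)]
      rw [dist_smul₀ (8 : ℝ) y z, Real.norm_of_nonneg (by norm_num)] at this
      linarith
    · intro z hz
      rw [dist_zero_right] at hz
      simp only [shrinkConj_of_le hu hz.ge]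

end stretch

/-! ### Finite approximations and their inverses. -/

/-- Admissible sequences of ratios for the target Cantor set. -/
def AdmissibleRatios (μ : ℕ → ℝ) : Prop := ∀ k, 1 / 4 ≤ μ k ∧ μ k < 1 / 2

theorem AdmissibleRatios.shift {μ : ℕ → ℝ} (h : AdmissibleRatios μ) :
    AdmissibleRatios fun k => μ (k + 1) := fun k => h (k + 1)

/-- The `n`-th approximation of the map that carries the Cantor set with ratios `1/8` onto the
Cantor set with ratios `μ`. -/
noncomputable def approxMap : ℕ → (ℕ → ℝ) → SupPlane → SupPlane
  | 0, _ => id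
  | n + 1, μ => plant fun v => stretch (μ 0) (shrinkConj (approxMap n fun k => μ (k + 1)) v)

/-- The inverse of `approxMap n μ`. -/
noncomputable def approxInv : ℕ → (ℕ → ℝ) → SupPlane → SupPlane
  | 0, _ => id
  | n + 1, μ => plant fun v => shrinkConj (approxInv n fun k => μ (k + 1)) (squeeze (μ 0) v)

section approx
variable {μ : ℕ → ℝ}

theorem unitBallMap_plant {W : SupPlane → SupPlane} (hW : ∀ v, 1 / 2 ≤ ‖v‖ → W v = v)
    (hWb : ∀ v, ‖v‖ ≤ 1 / 2 → ‖W v‖ ≤ 1 / 2) : UnitBallMap (plant W) :=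
  ⟨fun _ hv => plant_of_one_le hW hv, fun _ hv => norm_plant_le hWb hv⟩

theorem stretch_shrinkConj_of_ge {m : ℝ} {u : SupPlane → SupPlane} (h1 : 1 / 4 ≤ m)
    (hu : UnitBallMap u) {v : SupPlane} (hv : 1 / 2 ≤ ‖v‖) : stretch m (shrinkConj u v) = v := by
  rw [shrinkConj_of_le hu (by linarith), stretch_of_ge h1 hv]

theorem shrinkConj_squeeze_of_ge {m : ℝ} {u : SupPlane → SupPlane} (h1 : 1 / 4 ≤ m)
    (h2 : m < 1 / 2) (hu : UnitBallMap u) {v : SupPlane} (hv : 1 / 2 ≤ ‖v‖) :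
    shrinkConj u (squeeze m v) = v := by
  rw [squeeze_of_ge h1 h2 hv, shrinkConj_of_le hu (by linarith)]

theorem unitBallMap_id : UnitBallMap id := ⟨fun _ _ => rfl, fun _ h => h⟩

theorem unitBallMap_approxMap (hμ : AdmissibleRatios μ) (n : ℕ) :
    UnitBallMap (approxMap n μ) := by
  induction n generalizing μ with
  | zero => exact unitBallMap_id
  | succ n ih =>
    obtain ⟨h1, h2⟩ := hμ 0
    exact unitBallMap_plant (fun v hv => stretch_shrinkConj_of_ge h1 (ih hμ.shift) hv)
      (fun v hv => norm_stretch_le h1 h2 (norm_shrinkConj_le_half (ih hμ.shift) hv))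

theorem unitBallMap_approxInv (hμ : AdmissibleRatios μ) (n : ℕ) :
    UnitBallMap (approxInv n μ) := by
  induction n generalizing μ with
  | zero => exact unitBallMap_id
  | succ n ih =>
    obtain ⟨h1, h2⟩ := hμ 0
    exact unitBallMap_plant (fun v hv => shrinkConj_squeeze_of_ge h1 h2 (ih hμ.shift) hv)
      (fun v hv => norm_shrinkConj_le_half (ih hμ.shift) ((norm_squeeze_le h1 v).trans hv))

theorem approxInv_approxMap (hμ : AdmissibleRatios μ) (n : ℕ) (x : SupPlane) :
    approxInv n μ (approxMap n μ x) = x := by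
  induction n generalizing μ x with
  | zero => rfl
  | succ n ih =>
    obtain ⟨h1, h2⟩ := hμ 0
    have hA := unitBallMap_approxMap hμ.shift n
    have hB := unitBallMap_approxInv hμ.shift n
    refine plant_leftInverse (fun v hv => stretch_shrinkConj_of_ge h1 hA hv)
      (fun v hv => shrinkConj_squeeze_of_ge h1 h2 hB hv)
      (fun v hv => norm_stretch_le h1 h2 (norm_shrinkConj_le_half hA hv)) (fun v => ?_) x
    rw [squeeze_stretch h1 h2, shrinkConj_leftInverse (ih hμ.shift)]

theorem approxMap_approxInv (hμ : AdmissibleRatios μ) (n : ℕ) (x : SupPlane) :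
    approxMap n μ (approxInv n μ x) = x := by
  induction n generalizing μ x with
  | zero => rfl
  | succ n ih =>
    obtain ⟨h1, h2⟩ := hμ 0
    have hA := unitBallMap_approxMap hμ.shift n
    have hB := unitBallMap_approxInv hμ.shift n
    refine plant_leftInverse (fun v hv => shrinkConj_squeeze_of_ge h1 h2 hB hv)
      (fun v hv => stretch_shrinkConj_of_ge h1 hA hv)
      (fun v hv => norm_shrinkConj_le_half hB ((norm_squeeze_le h1 v).trans hv)) (fun v => ?_) x
    rw [shrinkConj_leftInverse (ih hμ.shift), stretch_squeeze h1 h2]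

theorem UnitBallMap.norm_sub_self_le {u : SupPlane → SupPlane} (hu : UnitBallMap u)
    (v : SupPlane) : ‖u v - v‖ ≤ 2 := by
  rcases le_total ‖v‖ 1 with h | h
  · linarith [norm_sub_le (u v) v, hu.norm_le v h]
  · rw [hu.eq_self v h, sub_self, norm_zero]; norm_num

theorem norm_approxMap_succ_sub_le (hμ : AdmissibleRatios μ) (n : ℕ) (x : SupPlane) :
    ‖approxMap (n + 1) μ x - approxMap n μ x‖ ≤ 2 / 2 ^ n := by
  induction n generalizing μ x with
  | zero => simpa [approxMap] using (unitBallMap_approxMap hμ 1).norm_sub_self_le x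
  | succ n ih =>
    obtain ⟨h1, h2⟩ := hμ 0
    refine norm_plant_sub_plant_le (fun v => ?_) x
    refine (norm_stretch_shrinkConj_sub_le h1 h2 (unitBallMap_approxMap hμ.shift (n + 1))
      (unitBallMap_approxMap hμ.shift n) (ih hμ.shift) v).trans ?_
    rw [pow_succ, div_div]

theorem norm_approxInv_succ_sub_le (hμ : AdmissibleRatios μ) (n : ℕ) (x : SupPlane) :
    ‖approxInv (n + 1) μ x - approxInv n μ x‖ ≤ 2 / 2 ^ n := by
  induction n generalizing μ x with
  | zero => simpa [approxInv] using (unitBallMap_approxInv hμ 1).norm_sub_self_le x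
  | succ n ih =>
    refine norm_plant_sub_plant_le (fun v => ?_) x
    refine (norm_shrinkConj_sub_le (ih hμ.shift) (squeeze (μ 0) v)).trans ?_
    -- The contraction factor here is `1 / 8`; it is weakened to `1 / 2` to match the rate for
    -- `approxMap`.
    rw [pow_succ, ← div_div]
    have : (0 : ℝ) ≤ 2 / 2 ^ n := by positivity
    linarith

theorem one_le_prod_eight_mul (hμ : AdmissibleRatios μ) (n : ℕ) :
    1 ≤ ∏ j ∈ Finset.range n, (8 * μ j) :=
  Finset.prod_induction _ (fun a : ℝ => 1 ≤ a) (fun _ _ => one_le_mul_of_one_le_of_one_le) le_rfl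
    fun j _ => by linarith [(hμ j).1]

theorem dist_approxMap_le (hμ : AdmissibleRatios μ) (n : ℕ) (x y : SupPlane) :
    dist (approxMap n μ x) (approxMap n μ y) ≤
      (12 * ∏ j ∈ Finset.range n, (8 * μ j)) * dist x y := by
  induction n generalizing μ x y with
  | zero =>
    simp only [approxMap, id, Finset.range_zero, Finset.prod_empty]
    linarith [dist_nonneg (x := x) (y := y)]
  | succ n ih =>
    obtain ⟨h1, h2⟩ := hμ 0
    have hA := unitBallMap_approxMap hμ.shift n
    have hL := one_le_prod_eight_mul hμ (n + 1)
    refine dist_plant_le (fun v hv => stretch_shrinkConj_of_ge h1 hA hv) (by linarith)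
      (dist_stretch_shrinkConj_le h1 h2 hA (by linarith) fun x y => ?_) x y
    rw [Finset.prod_range_succ']
    have := mul_le_mul_of_nonneg_left (ih hμ.shift x y) (by linarith : 0 ≤ 8 * μ 0)
    linarith

/-- Used only for the continuity of each approximate inverse, so the dependence of the constant on
`n` is irrelevant. -/
theorem exists_dist_approxInv_le (hμ : AdmissibleRatios μ) (n : ℕ) :
    ∃ L, 0 ≤ L ∧ ∀ x y, dist (approxInv n μ x) (approxInv n μ y) ≤ L * dist x y := by
  induction n generalizing μ with
  | zero => exact ⟨1, zero_le_one, fun x y => by simp [approxInv]⟩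
  | succ n ih =>
    obtain ⟨h1, h2⟩ := hμ 0
    obtain ⟨L, hL0, hL⟩ := ih hμ.shift
    obtain ⟨M, hM⟩ := exists_dist_squeeze_le h1 h2
    have h3 : L * M ≤ max 1 (L * M) := le_max_right _ _
    refine ⟨max 1 (L * M), by positivity, dist_plant_le
      (fun v hv => shrinkConj_squeeze_of_ge h1 h2 (unitBallMap_approxInv hμ.shift n) hv)
      (le_max_left _ _) fun v w => ?_⟩
    refine (dist_shrinkConj_le hL _ _).trans ?_
    refine (mul_le_mul_of_nonneg_left (hM v w) hL0).trans ?_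
    rw [← mul_assoc]
    gcongr

end approx

/-! ### Generations of squares of the source dust. -/

/-- The union of the squares of generation `n` of the Cantor set with ratios `1/8`. -/
def levelSet : ℕ → Set SupPlane
  | 0 => Metric.closedBall 0 1
  | n + 1 => ⋃ b, {x | (8 : ℝ) • (x - corner b) ∈ levelSet n}

theorem isClosed_levelSet (n : ℕ) : IsClosed (levelSet n) := by
  induction n with
  | zero => exact Metric.isClosed_closedBall
  | succ n ih =>
    exact isClosed_iUnion_of_finite fun b => ih.preimage (by fun_prop)

theorem levelSet_succ_subset (n : ℕ) : levelSet (n + 1) ⊆ levelSet n := by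
  induction n with
  | zero =>
    intro x hx
    obtain ⟨b, hb⟩ := Set.mem_iUnion.1 hx
    simp only [levelSet, Set.mem_ofPred_eq, mem_closedBall_zero_iff, norm_eight_smul] at hb ⊢
    have := norm_corner_add_le (b := b) (w := x - corner b) (by linarith)
    simpa using this
  | succ n ih =>
    exact Set.iUnion_mono fun b x hx => ih hx

theorem exists_levelSet_cover (n : ℕ) : ∃ P : Finset SupPlane, P.card ≤ 4 ^ n ∧
    ∀ x ∈ levelSet n, ∃ y ∈ P, dist x y ≤ 1 / 8 ^ n := by
  classical
  induction n with
  | zero =>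
    refine ⟨{0}, by simp, fun x hx => ⟨0, by simp, ?_⟩⟩
    simpa [levelSet] using hx
  | succ n ih =>
    obtain ⟨P, hP, h⟩ := ih
    refine ⟨(Finset.univ ×ˢ P).image fun q => corner q.1 + (1 / 8 : ℝ) • q.2, ?_, ?_⟩
    · refine Finset.card_image_le.trans ?_
      rw [Finset.card_product, Finset.card_univ]
      simp only [Fintype.card_pi, Fintype.card_bool, Finset.prod_const, Finset.card_univ,
        Fintype.card_fin]
      rw [pow_succ]; omega
    · intro x hx
      obtain ⟨b, hb⟩ := Set.mem_iUnion.1 hx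
      obtain ⟨y, hy, hxy⟩ := h _ hb
      refine ⟨corner b + (1 / 8 : ℝ) • y, Finset.mem_image.2 ⟨(b, y), by simp [hy], rfl⟩, ?_⟩
      have e : x - (corner b + (1 / 8 : ℝ) • y) =
          (1 / 8 : ℝ) • ((8 : ℝ) • (x - corner b) - y) := by
        rw [smul_sub, smul_smul]; norm_num [sub_sub]
      rw [dist_eq_norm, e, norm_eighth_smul, ← dist_eq_norm, pow_succ, ← div_div]
      linarith

/-- Refinements after generation `n` happen only inside its squares. This stabilization gives access
to the derivative of the limit. -/
theorem approxMap_eq_of_notMem {μ : ℕ → ℝ} (hμ : AdmissibleRatios μ) {n : ℕ} {x : SupPlane}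
    (hx : x ∉ levelSet n) {m : ℕ} (hm : n ≤ m) : approxMap m μ x = approxMap n μ x := by
  obtain ⟨j, rfl⟩ := Nat.exists_eq_add_of_le hm
  clear hm
  induction n generalizing μ x with
  | zero =>
    simp only [levelSet, mem_closedBall_zero_iff, not_le] at hx
    rw [(unitBallMap_approxMap hμ _).eq_self _ hx.le, (unitBallMap_approxMap hμ _).eq_self _ hx.le]
  | succ n ih =>
    have h := ih hμ.shift (fun h => hx (Set.mem_iUnion.2 ⟨quadrant x, h⟩))
    rw [show n + 1 + j = (n + j) + 1 by omega]
    simp only [approxMap, plant, shrinkConj, h]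

/-! ### The limit homeomorphism. -/

section limit
variable {μ : ℕ → ℝ}

/-- The limit of the maps `approxMap n μ`. -/
noncomputable def limitMap (μ : ℕ → ℝ) (x : SupPlane) : SupPlane :=
  limUnder atTop fun n => approxMap n μ x

/-- The limit of the maps `approxInv n μ`. -/
noncomputable def limitInv (μ : ℕ → ℝ) (x : SupPlane) : SupPlane :=
  limUnder atTop fun n => approxInv n μ x

theorem dist_approxMap_succ_le (hμ : AdmissibleRatios μ) (x : SupPlane) (n : ℕ) :
    dist (approxMap n μ x) (approxMap (n + 1) μ x) ≤ 4 / 2 / 2 ^ n := by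
  rw [dist_comm, dist_eq_norm]
  exact (norm_approxMap_succ_sub_le hμ n x).trans (by norm_num)

theorem dist_approxInv_succ_le (hμ : AdmissibleRatios μ) (x : SupPlane) (n : ℕ) :
    dist (approxInv n μ x) (approxInv (n + 1) μ x) ≤ 4 / 2 / 2 ^ n := by
  rw [dist_comm, dist_eq_norm]
  exact (norm_approxInv_succ_sub_le hμ n x).trans (by norm_num)

theorem tendsto_approxMap (hμ : AdmissibleRatios μ) (x : SupPlane) :
    Tendsto (fun n => approxMap n μ x) atTop (𝓝 (limitMap μ x)) :=
  (cauchySeq_of_le_geometric_two (dist_approxMap_succ_le hμ x)).tendsto_limUnder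

theorem tendsto_approxInv (hμ : AdmissibleRatios μ) (x : SupPlane) :
    Tendsto (fun n => approxInv n μ x) atTop (𝓝 (limitInv μ x)) :=
  (cauchySeq_of_le_geometric_two (dist_approxInv_succ_le hμ x)).tendsto_limUnder

theorem dist_approxMap_limitMap_le (hμ : AdmissibleRatios μ) (n : ℕ) (x : SupPlane) :
    dist (approxMap n μ x) (limitMap μ x) ≤ 4 / 2 ^ n :=
  dist_le_of_le_geometric_two_of_tendsto (dist_approxMap_succ_le hμ x) (tendsto_approxMap hμ x) n

theorem dist_approxInv_limitInv_le (hμ : AdmissibleRatios μ) (n : ℕ) (x : SupPlane) :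
    dist (approxInv n μ x) (limitInv μ x) ≤ 4 / 2 ^ n :=
  dist_le_of_le_geometric_two_of_tendsto (dist_approxInv_succ_le hμ x) (tendsto_approxInv hμ x) n

theorem tendsto_four_div_two_pow : Tendsto (fun n : ℕ => (4 : ℝ) / 2 ^ n) atTop (𝓝 0) :=
  tendsto_const_nhds.div_atTop (tendsto_pow_atTop_atTop_of_one_lt one_lt_two)

theorem tendstoUniformly_of_dist_le {u : ℕ → SupPlane → SupPlane} {v : SupPlane → SupPlane}
    (h : ∀ n x, dist (u n x) (v x) ≤ 4 / 2 ^ n) : TendstoUniformly u v atTop := by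
  rw [Metric.tendstoUniformly_iff]
  intro ε hε
  filter_upwards [tendsto_four_div_two_pow.eventually (gt_mem_nhds hε)] with n hn x
  rw [dist_comm]
  exact (h n x).trans_lt hn

theorem continuous_of_dist_le_mul {X Y : Type*} [PseudoMetricSpace X] [PseudoMetricSpace Y]
    {f : X → Y} {L : ℝ} (h : ∀ x y, dist (f x) (f y) ≤ L * dist x y) : Continuous f :=
  (LipschitzWith.of_dist_le' h).continuous

theorem continuous_limitMap (hμ : AdmissibleRatios μ) : Continuous (limitMap μ) :=
  (tendstoUniformly_of_dist_le (dist_approxMap_limitMap_le hμ)).continuous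
    (Frequently.of_forall fun n => continuous_of_dist_le_mul (dist_approxMap_le hμ n))

theorem continuous_limitInv (hμ : AdmissibleRatios μ) : Continuous (limitInv μ) :=
  (tendstoUniformly_of_dist_le (dist_approxInv_limitInv_le hμ)).continuous
    (Frequently.of_forall fun n =>
      continuous_of_dist_le_mul (exists_dist_approxInv_le hμ n).choose_spec.2)

/-- Uniform convergence of the approximate inverses permits passing to the limit in `approxInv n μ
(approxMap n μ x) = x`. -/
theorem limitInv_limitMap (hμ : AdmissibleRatios μ) (x : SupPlane) :
    limitInv μ (limitMap μ x) = x := by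
  refine tendsto_nhds_unique ((tendstoUniformly_of_dist_le
    (dist_approxInv_limitInv_le hμ)).tendsto_comp (continuous_limitInv hμ).continuousAt
    (tendsto_approxMap hμ x)) ?_
  simp only [approxInv_approxMap hμ, tendsto_const_nhds]

theorem limitMap_limitInv (hμ : AdmissibleRatios μ) (x : SupPlane) :
    limitMap μ (limitInv μ x) = x := by
  refine tendsto_nhds_unique ((tendstoUniformly_of_dist_le
    (dist_approxMap_limitMap_le hμ)).tendsto_comp (continuous_limitMap hμ).continuousAt
    (tendsto_approxInv hμ x)) ?_
  simp only [approxMap_approxInv hμ, tendsto_const_nhds]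

/-- The homeomorphism that carries the Cantor set with ratios `1/8` onto the Cantor set with
ratios `μ`. -/
noncomputable def limitHomeo (hμ : AdmissibleRatios μ) : SupPlane ≃ₜ SupPlane where
  toFun := limitMap μ
  invFun := limitInv μ
  left_inv := limitInv_limitMap hμ
  right_inv := limitMap_limitInv hμ
  continuous_toFun := continuous_limitMap hμ
  continuous_invFun := continuous_limitInv hμ

theorem unitBallMap_limitMap (hμ : AdmissibleRatios μ) : UnitBallMap (limitMap μ) := by
  refine ⟨fun v hv => tendsto_nhds_unique (tendsto_approxMap hμ v) ?_, fun v hv => ?_⟩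
  · simp only [(unitBallMap_approxMap hμ _).eq_self v hv, tendsto_const_nhds]
  · exact le_of_tendsto (tendsto_approxMap hμ v).norm
      (Eventually.of_forall fun n => (unitBallMap_approxMap hμ n).norm_le v hv)

theorem limitMap_eq_of_notMem (hμ : AdmissibleRatios μ) {n : ℕ} {x : SupPlane}
    (hx : x ∉ levelSet n) : limitMap μ x = approxMap n μ x := by
  refine tendsto_nhds_unique (tendsto_approxMap hμ x) (tendsto_const_nhds.congr' ?_)
  filter_upwards [eventually_ge_atTop n] with m hm
  exact (approxMap_eq_of_notMem hμ hx hm).symm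

/-- The recursion passes to the limit: inside a first generation square the limit map is a rescaled
limit map for the shifted ratios. -/
theorem limitMap_corner_add (hμ : AdmissibleRatios μ) (b : Fin 2 → Bool) {v : SupPlane}
    (hv : ‖v‖ ≤ 1) : limitMap μ (corner b + (1 / 8 : ℝ) • v) =
      corner b + μ 0 • limitMap (fun k => μ (k + 1)) v := by
  obtain ⟨h1, h2⟩ := hμ 0
  have hv' : ‖(1 / 8 : ℝ) • v‖ ≤ 1 / 8 := by rw [norm_eighth_smul]; linarith
  refine tendsto_nhds_unique ((tendsto_add_atTop_iff_nat 1).2 (tendsto_approxMap hμ _)) ?_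
  refine (((tendsto_approxMap hμ.shift v).const_smul (μ 0)).const_add (corner b)).congr fun n => ?_
  have hA := unitBallMap_approxMap hμ.shift n
  rw [approxMap, plant_corner_add (fun v hv => stretch_shrinkConj_of_ge h1 hA hv)
    (by linarith), stretch_shrinkConj_of_le h1 hA hv', smul_smul]
  norm_num

end limit

/-! ### Weak derivatives of a stabilizing limit of Lipschitz functions. -/

/-- A function that coincides, off a closed set `A (k + 1)`, with an `L k`-Lipschitz function, has
weak derivatives in `L²_loc` provided that `∑ (L k)² |A k ∩ K|` is finite for compact `K`. -/
theorem exists_hasWeakPartialDeriv_of_stabilizing {n : ℕ} {u : EuclideanSpace ℝ (Fin n) → ℝ}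
    (hu : Continuous u) {w : ℕ → EuclideanSpace ℝ (Fin n) → ℝ} {L : ℕ → ℝ≥0}
    (hw : ∀ k, LipschitzWith (L k) (w k)) {A : ℕ → Set (EuclideanSpace ℝ (Fin n))}
    (hA : ∀ k, IsClosed (A k)) (hanti : Antitone A) (h0 : A 0 = Set.univ)
    (hstab : ∀ k x, x ∉ A (k + 1) → u x = w k x) {M : ℝ} (hM : ∀ k x, |w k x - u x| ≤ M)
    (hlim : ∀ x, Tendsto (fun k => w k x) atTop (𝓝 (u x)))
    (hnull : volume (⋂ k, A k) = 0)
    (hsum : ∀ K, IsCompact K → ∑' k, (L k : ℝ≥0∞) ^ 2 * volume (A k ∩ K) ≠ ⊤) (i : Fin n) :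
    ∃ v, MemLpLoc 2 v ∧ HasWeakPartialDeriv i u v := by
  set e : EuclideanSpace ℝ (Fin n) := EuclideanSpace.single i 1 with he
  have hne : ‖e‖ = 1 := by simp [he]
  -- The candidate is the pointwise directional derivative, with default value `0` where it does not
  -- exist. Off `A (k + 1)` it agrees with that of `w k`, since the two functions agree on an open
  -- set.
  let v : EuclideanSpace ℝ (Fin n) → ℝ := fun x => lineDeriv ℝ u x e
  -- A single locally integrable function bounding the squared derivatives of `u` (off the null set)
  -- and of every `w k`.
  let F : EuclideanSpace ℝ (Fin n) → ℝ≥0∞ :=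
    fun x => ∑' k, (A k).indicator (fun _ => (L k : ℝ≥0∞) ^ 2) x
  have hFm : Measurable F := Measurable.tsum fun k =>
    measurable_const.indicator (hA k).measurableSet
  have hle : ∀ k x, x ∈ A k → (L k : ℝ≥0∞) ^ 2 ≤ F x := by
    intro k x hx
    refine le_trans ?_ (ENNReal.le_tsum k)
    rw [Set.indicator_of_mem hx]
  have hFtop : ∀ x, x ∉ ⋂ k, A k → F x ≠ ⊤ := by
    intro x hx
    obtain ⟨k, hk⟩ := not_forall.1 (fun h => hx (Set.mem_iInter.2 h))
    have : F x = ∑ j ∈ Finset.range k, (A j).indicator (fun _ => (L j : ℝ≥0∞) ^ 2) x := by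
      refine tsum_eq_sum fun j hj => Set.indicator_of_notMem (fun h => hk ?_) _
      exact hanti (by simpa using hj) h
    rw [this]
    refine (ENNReal.sum_lt_top.2 fun j _ => ?_).ne
    refine (Set.indicator_le_self' (fun _ _ => zero_le) x).trans_lt ?_
    exact ENNReal.pow_lt_top ENNReal.coe_lt_top
  have hFint : ∀ K, IsCompact K → ∫⁻ x in K, F x ≠ ⊤ := by
    intro K hK
    rw [lintegral_tsum fun k => (measurable_const.indicator (hA k).measurableSet).aemeasurable]
    convert hsum K hK using 3 with k
    rw [lintegral_indicator_const (hA k).measurableSet, Measure.restrict_apply (hA k).measurableSet]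
  have hvw : ∀ k x, x ∉ A (k + 1) → lineDeriv ℝ (w k) x e = v x := by
    intro k x hx
    refine Filter.EventuallyEq.lineDeriv_eq ?_
    filter_upwards [(hA (k + 1)).isOpen_compl.mem_nhds hx] with y hy
    exact (hstab k y hy).symm
  have hwL : ∀ k x, ‖lineDeriv ℝ (w k) x e‖ ≤ L k := by
    intro k x
    simpa [hne] using norm_lineDeriv_le_of_lipschitz ℝ (hw k) (x₀ := x) (v := e)
  have hwL' : ∀ k x, x ∈ A k → ‖lineDeriv ℝ (w k) x e‖ₑ ^ 2 ≤ F x := by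
    intro k x hx
    refine le_trans (pow_le_pow_left₀ zero_le ?_ 2) (hle k x hx)
    rw [← ofReal_norm, ← ENNReal.ofReal_coe_nnreal]
    exact ENNReal.ofReal_le_ofReal (hwL k x)
  have hvF : ∀ k x, x ∉ A (k + 1) → ‖v x‖ₑ ^ 2 ≤ F x := by
    intro k
    induction k with
    | zero =>
      intro x hx
      rw [← hvw 0 x hx]
      exact hwL' 0 x (by simp [h0])
    | succ k ih =>
      intro x hx
      by_cases h : x ∈ A (k + 1)
      · rw [← hvw (k + 1) x hx]
        exact hwL' (k + 1) x h
      · exact ih x h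
  have hwF : ∀ k x, ‖lineDeriv ℝ (w k) x e‖ₑ ^ 2 ≤ F x := by
    intro k x
    by_cases h : x ∈ A k
    · exact hwL' k x h
    · have h' : x ∉ A (k + 1) := fun h2 => h (hanti (Nat.le_succ k) h2)
      rw [hvw k x h']
      exact hvF k x h'
  have hae : ∀ᵐ x, ∃ k, x ∉ A (k + 1) := by
    filter_upwards [measure_eq_zero_iff_ae_notMem.1 hnull] with x hx
    obtain ⟨k, hk⟩ := not_forall.1 (fun h => hx (Set.mem_iInter.2 h))
    exact ⟨k, fun h => hk (hanti (Nat.le_succ k) h)⟩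
  have hvmeas : Measurable v := measurable_lineDeriv hu
  have hvLp : MemLpLoc 2 v := by
    intro K hK
    refine ⟨hvmeas.aestronglyMeasurable, ?_⟩
    rw [eLpNorm_lt_top_iff_lintegral_rpow_enorm_lt_top two_ne_zero ENNReal.ofNat_ne_top]
    refine lt_of_le_of_lt (lintegral_mono_ae ?_) (hFint K hK).lt_top
    filter_upwards [ae_restrict_of_ae hae] with x hx
    obtain ⟨k, hk⟩ := hx
    simpa using hvF k x hk
  refine ⟨v, hvLp, hu.locallyIntegrable, ?_, fun φ hφ hφc => ?_⟩
  · rw [locallyIntegrable_iff]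
    intro K hK
    have : IsFiniteMeasure (volume.restrict K) := ⟨by simpa using hK.measure_lt_top⟩
    exact (hvLp K hK).integrable (by norm_num)
  · obtain ⟨D, hD⟩ := hφ.lipschitzWith_of_hasCompactSupport hφc (by simp)
    have hφd : Differentiable ℝ φ := hφ.differentiable (by simp)
    -- Integration by parts holds for each Lipschitz `w k`; it remains to pass to the limit by
    -- dominated convergence on both sides.
    have hparts : ∀ k, ∫ x, w k x * fderiv ℝ φ x e = - ∫ x, lineDeriv ℝ (w k) x e * φ x := by
      intro k
      rw [(hw k).integral_lineDeriv_mul_eq hD hφc e, ← integral_neg]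
      congr 1 with x
      rw [(hφd x).lineDeriv_eq_fderiv, map_neg]
      ring
    have hdc : Continuous fun x => fderiv ℝ φ x e :=
      (hφ.continuous_fderiv (by simp)).clm_apply continuous_const
    have hds : HasCompactSupport fun x => fderiv ℝ φ x e := hφc.fderiv_apply ℝ e
    have hL1 : Tendsto (fun k => ∫ x, w k x * fderiv ℝ φ x e) atTop
        (𝓝 (∫ x, u x * fderiv ℝ φ x e)) := by
      refine tendsto_integral_of_dominated_convergence
        (fun x => (M + |u x|) * |fderiv ℝ φ x e|)
        (fun k => ((hw k).continuous.mul hdc).aestronglyMeasurable) ?_ ?_ ?_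
      · refine Continuous.integrable_of_hasCompactSupport
          ((continuous_const.add hu.abs).mul hdc.abs) ?_
        exact HasCompactSupport.mul_left (hds.comp_left (g := abs) abs_zero)
      · refine fun k => Eventually.of_forall fun x => ?_
        rw [norm_mul]
        refine mul_le_mul_of_nonneg_right ?_ (norm_nonneg _)
        have := abs_add_le (w k x - u x) (u x)
        rw [sub_add_cancel] at this
        exact this.trans (add_le_add (hM k x) le_rfl)
      · exact Eventually.of_forall fun x => (hlim x).mul_const _
    have hL2 : Tendsto (fun k => ∫ x, lineDeriv ℝ (w k) x e * φ x) atTop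
        (𝓝 (∫ x, v x * φ x)) := by
      refine tendsto_integral_of_dominated_convergence
        -- Since `t ≤ 1 + t²`, the bound on squares also dominates the derivatives themselves.
        (fun x => (1 + (F x).toReal) * |φ x|)
        (fun k => ((measurable_lineDeriv (hw k).continuous).mul
          hφ.continuous.measurable).aestronglyMeasurable) ?_ ?_ ?_
      · have hsupp : Function.support (fun x => (1 + (F x).toReal) * |φ x|) ⊆ tsupport φ := by
          intro x hx
          refine subset_tsupport φ ?_
          intro h
          simp [h] at hx
        rw [← integrableOn_iff_integrable_of_support_subset hsupp]
        obtain ⟨B, hB⟩ := hφc.exists_bound_of_continuous hφ.continuous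
        have : IsFiniteMeasure (volume.restrict (tsupport φ)) :=
          ⟨by simpa using hφc.isCompact.measure_lt_top⟩
        have hi : Integrable (fun x => 1 + (F x).toReal) (volume.restrict (tsupport φ)) :=
          (integrable_const _).add
            (integrable_toReal_of_lintegral_ne_top hFm.aemeasurable (hFint _ hφc.isCompact))
        refine Integrable.mul_bdd (c := B) hi hφ.continuous.abs.aestronglyMeasurable
          (Eventually.of_forall fun x => ?_)
        simpa using hB x
      · intro k
        filter_upwards [measure_eq_zero_iff_ae_notMem.1 hnull] with x hx
        rw [norm_mul]
        refine mul_le_mul_of_nonneg_right ?_ (norm_nonneg _)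
        have h1 := ENNReal.toReal_mono (hFtop x hx) (hwF k x)
        rw [ENNReal.toReal_pow, toReal_enorm] at h1
        nlinarith [norm_nonneg (lineDeriv ℝ (w k) x e), sq_nonneg (‖lineDeriv ℝ (w k) x e‖ - 1)]
      · filter_upwards [hae] with x hx
        obtain ⟨k, hk⟩ := hx
        refine tendsto_const_nhds.congr' ?_
        filter_upwards [eventually_ge_atTop k] with j hj
        rw [hvw j x fun h => hk (hanti (Nat.succ_le_succ hj) h)]
    refine tendsto_nhds_unique hL1 ?_
    simp only [hparts]
    exact hL2.neg

/-! ### Sobolev regularity in the Euclidean plane. -/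

/-- The affine homeomorphism that carries the unit ball of `SupPlane` onto `[0, 1]²`. -/
noncomputable def squareChart : SupPlane ≃ₜ EuclideanSpace ℝ (Fin 2) where
  toFun v := WithLp.toLp 2 fun i => (v i + 1) / 2
  invFun x i := 2 * x i - 1
  left_inv v := by ext i; simp; ring
  right_inv x := by ext i; simp
  continuous_toFun := by fun_prop
  continuous_invFun := by fun_prop

theorem squareChart_apply (v : SupPlane) (i : Fin 2) : squareChart v i = (v i + 1) / 2 := rfl

theorem squareChart_symm_apply (x : EuclideanSpace ℝ (Fin 2)) (i : Fin 2) :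
    squareChart.symm x i = 2 * x i - 1 := rfl

theorem dist_squareChart_le (v w : SupPlane) : dist (squareChart v) (squareChart w) ≤ dist v w := by
  rw [EuclideanSpace.dist_eq, Fin.sum_univ_two]
  have h : ∀ i, dist (squareChart v i) (squareChart w i) ≤ dist v w / 2 := by
    intro i
    rw [squareChart_apply, squareChart_apply, Real.dist_eq]
    have := dist_le_pi_dist v w i
    rw [Real.dist_eq] at this
    rw [show (v i + 1) / 2 - (w i + 1) / 2 = (v i - w i) / 2 by ring, abs_div, abs_two]
    linarith
  refine Real.sqrt_le_iff.2 ⟨dist_nonneg, ?_⟩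
  have h0 := pow_le_pow_left₀ dist_nonneg (h 0) 2
  have h1 := pow_le_pow_left₀ dist_nonneg (h 1) 2
  nlinarith [sq_nonneg (dist v w)]

theorem abs_coord_sub_le_dist (x y : EuclideanSpace ℝ (Fin 2)) (i : Fin 2) :
    |x i - y i| ≤ dist x y := by
  rw [dist_eq_norm, ← Real.norm_eq_abs]
  exact PiLp.norm_apply_le (x - y) i

theorem dist_le_two_mul_dist_squareChart (v w : SupPlane) :
    dist v w ≤ 2 * dist (squareChart v) (squareChart w) := by
  refine (dist_pi_le_iff (by positivity)).2 fun i => ?_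
  have := abs_coord_sub_le_dist (squareChart v) (squareChart w) i
  rw [squareChart_apply, squareChart_apply,
    show (v i + 1) / 2 - (w i + 1) / 2 = (v i - w i) / 2 by ring, abs_div, abs_two] at this
  rw [Real.dist_eq]
  linarith

theorem dist_squareChart_symm_le (x y : EuclideanSpace ℝ (Fin 2)) :
    dist (squareChart.symm x) (squareChart.symm y) ≤ 2 * dist x y := by
  simpa using dist_le_two_mul_dist_squareChart (squareChart.symm x) (squareChart.symm y)

theorem Continuous.memLpLoc {n : ℕ} {u : EuclideanSpace ℝ (Fin n) → ℝ} (hu : Continuous u)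
    (q : ℝ≥0∞) : MemLpLoc q u := by
  intro K hK
  obtain ⟨B, hB⟩ := hK.exists_bound_of_continuousOn hu.continuousOn
  have : IsFiniteMeasure (volume.restrict K) := ⟨by simpa using hK.measure_lt_top⟩
  refine MemLp.of_bound hu.aestronglyMeasurable B ?_
  filter_upwards [ae_restrict_mem hK.measurableSet] with x hx using hB x hx

/-- Preimages of `levelSet k` under an expanding map have small area. -/
theorem exists_volume_preimage_levelSet_le {G : EuclideanSpace ℝ (Fin 2) → SupPlane} {K' : ℝ}
    (hG' : ∀ x y, dist x y ≤ K' * dist (G x) (G y)) :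
    ∃ B : ℝ, 0 ≤ B ∧ ∀ k, volume (G ⁻¹' levelSet k) ≤ ENNReal.ofReal (B / 16 ^ k) := by
  have hK' : 0 ≤ |K'| := abs_nonneg _
  have hv : volume (Metric.ball (0 : EuclideanSpace ℝ (Fin 2)) 1) ≠ ⊤ :=
    Metric.isBounded_ball.measure_lt_top.ne
  set b := (volume (Metric.ball (0 : EuclideanSpace ℝ (Fin 2)) 1)).toReal with hb
  have hb0 : 0 ≤ b := ENNReal.toReal_nonneg
  refine ⟨(|K'| * 2) ^ 2 * b, by positivity, fun k => ?_⟩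
  obtain ⟨P, hP, hcov⟩ := exists_levelSet_cover k
  -- A nonempty preimage of a square lies in a disc of radius of order `8⁻ᵏ` about one of its own
  -- points, hence has area of order `64⁻ᵏ`. Summing over `4 ^ k` squares leaves `16⁻ᵏ`.
  have hpiece : ∀ y, volume (G ⁻¹' Metric.closedBall y (1 / 8 ^ k)) ≤
      ENNReal.ofReal ((|K'| * 2) ^ 2 * b / 64 ^ k) := by
    intro y
    rcases (G ⁻¹' Metric.closedBall y (1 / 8 ^ k)).eq_empty_or_nonempty with h | ⟨x, hx⟩
    · rw [h, measure_empty]; exact zero_le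
    · have hsub : G ⁻¹' Metric.closedBall y (1 / 8 ^ k) ⊆
          Metric.closedBall x (|K'| * 2 * (1 / 8 ^ k)) := by
        intro z hz
        rw [Set.mem_preimage, Metric.mem_closedBall] at hx hz
        rw [Metric.mem_closedBall]
        have h1 : dist (G z) (G x) ≤ 2 * (1 / 8 ^ k) := by
          linarith [dist_triangle_right (G z) (G x) y]
        calc dist z x ≤ K' * dist (G z) (G x) := hG' z x
          _ ≤ |K'| * dist (G z) (G x) := by gcongr; exact le_abs_self _
          _ ≤ |K'| * (2 * (1 / 8 ^ k)) := by gcongr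
          _ = _ := by ring
      refine (measure_mono hsub).trans ?_
      rw [Measure.addHaar_closedBall _ _ (by positivity), ← ENNReal.ofReal_toReal hv,
        ← ENNReal.ofReal_mul (by positivity)]
      apply ENNReal.ofReal_le_ofReal
      rw [finrank_euclideanSpace_fin, mul_pow, ← hb]
      rw [show (64 : ℝ) ^ k = (8 ^ k) ^ 2 by rw [← pow_mul, mul_comm, pow_mul]; norm_num]
      apply le_of_eq
      field_simp
  have hsub : G ⁻¹' levelSet k ⊆ ⋃ y ∈ P, G ⁻¹' Metric.closedBall y (1 / 8 ^ k) := by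
    intro x hx
    obtain ⟨y, hy, hxy⟩ := hcov _ hx
    exact Set.mem_biUnion hy hxy
  refine (measure_mono hsub).trans ((measure_biUnion_finset_le _ _).trans ?_)
  refine (Finset.sum_le_sum fun y _ => hpiece y).trans ?_
  rw [Finset.sum_const, nsmul_eq_mul, ← ENNReal.ofReal_natCast, ← ENNReal.ofReal_mul (by positivity)]
  apply ENNReal.ofReal_le_ofReal
  have hP' : (P.card : ℝ) ≤ 4 ^ k := by exact_mod_cast hP
  calc (P.card : ℝ) * ((|K'| * 2) ^ 2 * b / 64 ^ k)
      ≤ 4 ^ k * ((|K'| * 2) ^ 2 * b / 64 ^ k) := by gcongr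
    _ = (|K'| * 2) ^ 2 * b / 16 ^ k := by
        rw [show (64 : ℝ) ^ k = 4 ^ k * 16 ^ k by rw [← mul_pow]; norm_num]
        field_simp

theorem prod_eight_mul (μ : ℕ → ℝ) (n : ℕ) :
    ∏ j ∈ Finset.range n, (8 * μ j) = 4 ^ n * ∏ j ∈ Finset.range n, (2 * μ j) := by
  induction n with
  | zero => simp
  | succ n ih => rw [Finset.prod_range_succ, ih, Finset.prod_range_succ]; ring

/-- The bi-Lipschitz change of variable `G` is kept general so that one statement serves both `h`
(the inverse chart) and the composition `f` (the shear). -/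
theorem memSobolevOneLoc_limitMap_comp {μ : ℕ → ℝ} (hμ : AdmissibleRatios μ)
    (hs : Summable fun n => (∏ j ∈ Finset.range n, (2 * μ j)) ^ 2)
    {G : EuclideanSpace ℝ (Fin 2) → SupPlane} {K K' : ℝ} (hK : 0 ≤ K)
    (hG : ∀ x y, dist (G x) (G y) ≤ K * dist x y)
    (hG' : ∀ x y, dist x y ≤ K' * dist (G x) (G y)) :
    MemSobolevOneLoc 2 fun x => squareChart (limitMap μ (G x)) := by
  have hGc : Continuous G := continuous_of_dist_le_mul hG
  have hhc : Continuous fun x => limitMap μ (G x) := (continuous_limitMap hμ).comp hGc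
  intro j
  have hjc : Continuous fun x => squareChart (limitMap μ (G x)) j := by
    simp only [squareChart_apply]; fun_prop
  refine ⟨hjc.memLpLoc 2, ?_⟩
  obtain ⟨B, hB0, hB⟩ := exists_volume_preimage_levelSet_le hG'
  have hprod : ∀ n, 0 ≤ ∏ j ∈ Finset.range n, (8 * μ j) :=
    fun n => zero_le_one.trans (one_le_prod_eight_mul hμ n)
  let L : ℕ → ℝ≥0 := fun k => Real.toNNReal ((12 * ∏ j ∈ Finset.range (k + 1), (8 * μ j)) * K)
  -- The first set must be the whole plane. Its contribution is controlled by the area of the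
  -- compact set instead of by the generation bound.
  let A : ℕ → Set (EuclideanSpace ℝ (Fin 2)) :=
    fun k => if k = 0 then Set.univ else G ⁻¹' levelSet k
  have hA0 : A 0 = Set.univ := if_pos rfl
  have hAs : ∀ k, A (k + 1) = G ⁻¹' levelSet (k + 1) := fun k => if_neg (Nat.succ_ne_zero k)
  have hcoord : ∀ (v w : SupPlane), |(v j + 1) / 2 - (w j + 1) / 2| ≤ dist v w := by
    intro v w
    have := abs_coord_sub_le_dist (squareChart v) (squareChart w) j
    rw [squareChart_apply, squareChart_apply] at this
    exact this.trans (dist_squareChart_le v w)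
  refine exists_hasWeakPartialDeriv_of_stabilizing hjc (L := L) (A := A) (M := 4)
    (w := fun k x => (approxMap (k + 1) μ (G x) j + 1) / 2) ?_ ?_ ?_ hA0 ?_ ?_ ?_ ?_ ?_
  · intro k
    refine LipschitzWith.of_dist_le_mul fun x y => ?_
    rw [Real.coe_toNNReal _ (mul_nonneg (mul_nonneg (by norm_num) (hprod _)) hK), Real.dist_eq]
    refine (hcoord _ _).trans ((dist_approxMap_le hμ (k + 1) _ _).trans ?_)
    rw [mul_assoc _ K]
    exact mul_le_mul_of_nonneg_left (hG x y) (mul_nonneg (by norm_num) (hprod _))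
  · intro k
    cases k with
    | zero => rw [hA0]; exact isClosed_univ
    | succ k => rw [hAs]; exact (isClosed_levelSet _).preimage hGc
  · refine antitone_nat_of_succ_le fun k => ?_
    cases k with
    | zero => rw [hA0]; exact Set.subset_univ _
    | succ k => rw [hAs, hAs]; exact Set.preimage_mono (levelSet_succ_subset _)
  · intro k x hx
    rw [hAs] at hx
    rw [squareChart_apply, limitMap_eq_of_notMem hμ hx]
  · intro k x
    rw [squareChart_apply]
    refine (hcoord _ _).trans ((dist_approxMap_limitMap_le hμ _ _).trans ?_)
    exact div_le_self (by norm_num) (one_le_pow₀ (by norm_num))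
  · intro x
    have h1 := ((tendsto_add_atTop_iff_nat 1).2 (tendsto_approxMap hμ (G x)))
    exact (((tendsto_pi_nhds.1 h1 j).add_const 1).div_const 2)
  · have hle : ∀ k, volume (⋂ k, A k) ≤ ENNReal.ofReal (B / 16 ^ (k + 1)) := fun k =>
      (measure_mono (Set.iInter_subset _ (k + 1))).trans (by rw [hAs]; exact hB _)
    have hlim : Tendsto (fun k : ℕ => ENNReal.ofReal (B / 16 ^ (k + 1))) atTop (𝓝 0) := by
      rw [← ENNReal.ofReal_zero]
      refine ENNReal.tendsto_ofReal ?_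
      exact (tendsto_add_atTop_iff_nat (f := fun k : ℕ => B / 16 ^ k) 1).2
        (tendsto_const_nhds.div_atTop (tendsto_pow_atTop_atTop_of_one_lt (by norm_num)))
    exact le_antisymm (ge_of_tendsto' hlim hle) zero_le
  · intro S hS
    set B' := B + (volume S).toReal with hB'
    have hSt : 0 ≤ (volume S).toReal := ENNReal.toReal_nonneg
    have hvol : ∀ k, volume (A k ∩ S) ≤ ENNReal.ofReal (B' / 16 ^ k) := by
      intro k
      cases k with
      | zero =>
        rw [hA0, Set.univ_inter, ← ENNReal.ofReal_toReal hS.measure_lt_top.ne]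
        apply ENNReal.ofReal_le_ofReal
        simp [hB', hB0]
      | succ k =>
        rw [hAs]
        refine (measure_mono Set.inter_subset_left).trans ((hB _).trans ?_)
        apply ENNReal.ofReal_le_ofReal
        gcongr
        linarith
    -- The growth `16 ^ k` of the squared Lipschitz constant cancels the area `16⁻ᵏ`. The
    -- approximation used on generation `k` has index `k + 1`, which costs the extra factor `8 * μ k
    -- ≤ 4`.
    have hterm : ∀ k, (L k : ℝ≥0∞) ^ 2 * volume (A k ∩ S) ≤
        ENNReal.ofReal ((12 * 4 * K) ^ 2 * B' * (∏ j ∈ Finset.range k, (2 * μ j)) ^ 2) := by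
      intro k
      refine (mul_le_mul_right (hvol k) _).trans ?_
      have hLk : (L k : ℝ≥0∞) =
          ENNReal.ofReal ((12 * ∏ j ∈ Finset.range (k + 1), (8 * μ j)) * K) := rfl
      rw [hLk, ← ENNReal.ofReal_pow (mul_nonneg (mul_nonneg (by norm_num) (hprod _)) hK),
        ← ENNReal.ofReal_mul (sq_nonneg _)]
      apply ENNReal.ofReal_le_ofReal
      have e : ∏ j ∈ Finset.range (k + 1), (8 * μ j) =
          4 ^ k * (∏ j ∈ Finset.range k, (2 * μ j)) * (8 * μ k) := by
        rw [Finset.prod_range_succ, prod_eight_mul]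
      rw [e]
      set p := ∏ j ∈ Finset.range k, (2 * μ j)
      have h16 : (16 : ℝ) ^ k = (4 ^ k) ^ 2 := by
        rw [← pow_mul, mul_comm, pow_mul]; norm_num
      have h3 : (8 * μ k) ^ 2 ≤ 4 ^ 2 :=
        pow_le_pow_left₀ (by linarith [(hμ k).1]) (by linarith [(hμ k).2]) 2
      calc (12 * (4 ^ k * p * (8 * μ k)) * K) ^ 2 * (B' / 16 ^ k)
          = (12 * K) ^ 2 * B' * p ^ 2 * (8 * μ k) ^ 2 := by rw [h16]; field_simp
        _ ≤ (12 * K) ^ 2 * B' * p ^ 2 * 4 ^ 2 := by gcongr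
        _ = _ := by ring
    refine ne_top_of_le_ne_top ?_ (ENNReal.tsum_le_tsum hterm)
    exact (hs.mul_left _).tsum_ofReal_ne_top

/-! ### Hölder continuity. -/

theorem prod_eight_mul_le {μ : ℕ → ℝ} (hμ : AdmissibleRatios μ) (n : ℕ) :
    ∏ j ∈ Finset.range n, (8 * μ j) ≤ 4 ^ n := by
  refine (Finset.prod_le_prod (g := fun _ => (4 : ℝ)) (fun j _ => ?_) fun j _ => ?_).trans (by simp)
  · linarith [(hμ j).1]
  · linarith [(hμ j).2]

theorem dist_limitMap_le_of_approx {μ : ℕ → ℝ} (hμ : AdmissibleRatios μ) (n : ℕ)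
    (x y : SupPlane) :
    dist (limitMap μ x) (limitMap μ y) ≤ 8 / 2 ^ n + 12 * 4 ^ n * dist x y := by
  have h1 := dist_approxMap_limitMap_le hμ n x
  have h2 := dist_approxMap_limitMap_le hμ n y
  have h3 := dist_approxMap_le hμ n x y
  have h4 := mul_le_mul_of_nonneg_right (prod_eight_mul_le hμ n) (dist_nonneg (x := x) (y := y))
  have h5 := dist_triangle4 (limitMap μ x) (approxMap n μ x) (approxMap n μ y) (limitMap μ y)
  rw [dist_comm (limitMap μ x) (approxMap n μ x)] at h5
  have h6 : (8 : ℝ) / 2 ^ n = 4 / 2 ^ n + 4 / 2 ^ n := by ring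
  linarith

/-- Choose `n` with `dist x y` comparable to `8⁻ⁿ`. Then the approximation error `8 / 2 ^ n` and the
Lipschitz term `12 * 4 ^ n * dist x y` are both of order `2⁻ⁿ`, the cube root of the distance; they
contribute `16` and `12` to the constant. -/
theorem dist_limitMap_le_rpow {μ : ℕ → ℝ} (hμ : AdmissibleRatios μ) {x y : SupPlane}
    (hxy : dist x y ≤ 1) :
    dist (limitMap μ x) (limitMap μ y) ≤ 28 * dist x y ^ (1 / 3 : ℝ) := by
  rcases (dist_nonneg (x := x) (y := y)).eq_or_lt with h0 | h0
  · rw [dist_eq_zero.1 h0.symm, dist_self, dist_self, Real.zero_rpow (by norm_num), mul_zero]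
  · obtain ⟨n, hn1, hn2⟩ := exists_nat_pow_near_of_lt_one h0 hxy
      (by norm_num : (0 : ℝ) < 1 / 8) (by norm_num)
    refine (dist_limitMap_le_of_approx hμ n x y).trans ?_
    set r := dist x y ^ (1 / 3 : ℝ) with hr
    have hr0 : 0 < r := Real.rpow_pos_of_pos h0 _
    have hr3 : r ^ 3 = dist x y := by
      rw [hr, ← Real.rpow_natCast, ← Real.rpow_mul h0.le]; norm_num
    rw [← hr3] at hn1 hn2 ⊢
    have e : ∀ k : ℕ, ((1 : ℝ) / 8) ^ k = ((1 / 2) ^ k) ^ 3 := by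
      intro k; rw [← pow_mul, mul_comm, pow_mul]; norm_num
    rw [e] at hn1 hn2
    have h1 : (1 / 2 : ℝ) ^ (n + 1) < r := lt_of_pow_lt_pow_left₀ 3 hr0.le hn1
    have h2 : r ≤ (1 / 2 : ℝ) ^ n := le_of_pow_le_pow_left₀ (by norm_num) (by positivity) hn2
    have h3 : (8 : ℝ) / 2 ^ n ≤ 16 * r := by
      rw [pow_succ] at h1
      have : (8 : ℝ) / 2 ^ n = 8 * (1 / 2) ^ n := by rw [one_div, inv_pow]; rfl
      linarith
    have h4 : 2 ^ n * r ≤ 1 := by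
      calc 2 ^ n * r ≤ 2 ^ n * (1 / 2) ^ n := by gcongr
        _ = 1 := by rw [← mul_pow]; norm_num
    have h5 : (4 : ℝ) ^ n * r ^ 3 ≤ r := by
      have : (4 : ℝ) ^ n * r ^ 3 = (2 ^ n * r) ^ 2 * r := by
        rw [mul_pow, ← pow_mul, mul_comm n, pow_mul]; norm_num; ring
      rw [this]
      exact mul_le_of_le_one_left hr0.le (pow_le_one₀ (by positivity) h4)
    linarith

theorem holderOnWith_of_dist_le {X Y : Type*} [PseudoMetricSpace X] [PseudoMetricSpace Y]
    {f : X → Y} {C γ : ℝ≥0} {S : Set X}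
    (h : ∀ x ∈ S, ∀ y ∈ S, dist (f x) (f y) ≤ C * dist x y ^ (γ : ℝ)) : HolderOnWith C γ f S := by
  intro x hx y hy
  rw [edist_dist, edist_dist, ENNReal.ofReal_rpow_of_nonneg dist_nonneg γ.coe_nonneg,
    ← ENNReal.ofReal_coe_nnreal, ← ENNReal.ofReal_mul C.coe_nonneg]
  exact ENNReal.ofReal_le_ofReal (h x hx y hy)

theorem locallyHolder_limitMap {μ : ℕ → ℝ} (hμ : AdmissibleRatios μ) :
    LocallyHolder (limitMap μ) := by
  refine ⟨1 / 3, by norm_num, by rw [← NNReal.coe_le_coe]; norm_num, fun S hS => ?_⟩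
  obtain ⟨D, hD⟩ := Metric.isBounded_iff.1 hS.isBounded
  -- The second summand serves pairs at distance at most `1`. For the others, points move by at most
  -- `2`, so the images are at most `D + 4` apart.
  refine ⟨(28 + 5 * D).toNNReal + 28, holderOnWith_of_dist_le fun x hx y hy => ?_⟩
  have hγ : ((1 / 3 : ℝ≥0) : ℝ) = 1 / 3 := by norm_num
  have hC : 28 + 5 * D ≤ ((28 + 5 * D).toNNReal : ℝ) := Real.le_coe_toNNReal _
  have hC0 : 0 ≤ ((28 + 5 * D).toNNReal : ℝ) := NNReal.coe_nonneg _
  rw [hγ]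
  push_cast
  rcases le_total (dist x y) 1 with h | h
  · refine (dist_limitMap_le_rpow hμ h).trans ?_
    gcongr
    linarith
  · have h1 : 1 ≤ dist x y ^ (1 / 3 : ℝ) := Real.one_le_rpow h (by norm_num)
    have h2 := hD hx hy
    have h3 := (unitBallMap_limitMap hμ).norm_sub_self_le x
    have h4 := (unitBallMap_limitMap hμ).norm_sub_self_le y
    have h5 := dist_triangle4 (limitMap μ x) x y (limitMap μ y)
    rw [dist_eq_norm (limitMap μ x) x, dist_comm y, dist_eq_norm (limitMap μ y) y] at h5
    nlinarith

theorem LocallyHolder.comp_lipschitzWith {X Y Z : Type*} [PseudoEMetricSpace X]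
    [PseudoEMetricSpace Y] [PseudoEMetricSpace Z] {f : Y → Z} (hf : LocallyHolder f)
    {g : X → Y} {K : ℝ≥0} (hg : LipschitzWith K g) : LocallyHolder (f ∘ g) := by
  obtain ⟨γ, h0, h1, h⟩ := hf
  refine ⟨γ, h0, h1, fun S hS => ?_⟩
  obtain ⟨C, hC⟩ := h _ (hS.image hg.continuous)
  have := hC.comp (hg.holderWith.holderOnWith S) (Set.mapsTo_image g S)
  rw [mul_one] at this
  exact ⟨_, this⟩

theorem LipschitzWith.comp_locallyHolder {X Y Z : Type*} [PseudoEMetricSpace X]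
    [PseudoEMetricSpace Y] [PseudoEMetricSpace Z] {f : Y → Z} {K : ℝ≥0} (hf : LipschitzWith K f)
    {g : X → Y} (hg : LocallyHolder g) : LocallyHolder (f ∘ g) := by
  obtain ⟨γ, h0, h1, h⟩ := hg
  refine ⟨γ, h0, h1, fun S hS => ?_⟩
  obtain ⟨C, hC⟩ := h S hS
  have := hf.holderWith.comp_holderOnWith hC
  rw [one_mul] at this
  exact ⟨_, this⟩

theorem LipschitzWith.locallyHolder {X Y : Type*} [PseudoEMetricSpace X]
    [PseudoEMetricSpace Y] {f : X → Y} {K : ℝ≥0} (hf : LipschitzWith K f) : LocallyHolder f :=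
  ⟨1, one_pos, le_rfl, fun S _ => ⟨K, hf.holderWith.holderOnWith S⟩⟩

/-! ### Choice of the ratios. -/

/-- Ratios `μ` for which `∏_{j<n} 2 μ j` decays like `n ^ (-p / 2)`. -/
theorem exists_admissibleRatios {p : ℝ} (hp : 1 < p) : ∃ μ : ℕ → ℝ, AdmissibleRatios μ ∧
    (Summable fun n => (∏ j ∈ Finset.range n, (2 * μ j)) ^ 2) ∧
    ∃ c > 0, ∀ n : ℕ, 1 ≤ n → c ≤ (∏ j ∈ Finset.range (n + 1), (2 * μ j)) ^ 2 * (n : ℝ) ^ p := by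
  have hp0 : 0 < p := by linarith
  -- The ratios are chosen so that the product telescopes to `(M / (n + M)) ^ (p / 2)`. Taking `M`
  -- large makes the smallest ratio at least `1 / 4`.
  have hlim : Tendsto (fun M : ℕ => ((M : ℝ) / (M + 1)) ^ (p / 2)) atTop (𝓝 (1 ^ (p / 2))) :=
    (tendsto_natCast_div_add_atTop (1 : ℝ)).rpow_const (Or.inl one_ne_zero)
  rw [Real.one_rpow] at hlim
  obtain ⟨M, hM, hM1⟩ := ((hlim.eventually (lt_mem_nhds (by norm_num : (1 / 2 : ℝ) < 1))).and
    (eventually_ge_atTop 1)).exists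
  have hM0 : (0 : ℝ) < M := by exact_mod_cast hM1
  let μ : ℕ → ℝ := fun n => 1 / 2 * ((n + M) / (n + 1 + M)) ^ (p / 2)
  have hprod : ∀ n, ∏ j ∈ Finset.range n, (2 * μ j) = ((M : ℝ) / (n + M)) ^ (p / 2) := by
    intro n
    induction n with
    | zero => simp [hM0.ne']
    | succ n ih =>
      rw [Finset.prod_range_succ, ih]
      simp only [μ]
      rw [← mul_assoc 2, mul_one_div_cancel two_ne_zero, one_mul,
        ← Real.mul_rpow (by positivity) (by positivity)]
      push_cast
      congr 1
      field_simp
  have hsq : ∀ n, (∏ j ∈ Finset.range n, (2 * μ j)) ^ 2 = ((M : ℝ) / (n + M)) ^ p := by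
    intro n
    rw [hprod, ← Real.rpow_natCast, ← Real.rpow_mul (by positivity)]
    norm_num
  -- The quantity `n * M / (n + 1 + M)` increases with `n`, so its value at `n = 1` gives the
  -- constant.
  refine ⟨μ, fun n => ⟨?_, ?_⟩, ?_, ((1 : ℝ) * M / (M + 2)) ^ p, by positivity, fun n hn => ?_⟩
  · have h1 : ((M : ℝ) / (M + 1)) ≤ (n + M) / (n + 1 + M) := by
      rw [div_le_div_iff₀ (by positivity) (by positivity)]
      have : (0 : ℝ) ≤ n := n.cast_nonneg
      nlinarith
    have h2 := Real.rpow_le_rpow (by positivity) h1 (by linarith : 0 ≤ p / 2)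
    simp only [μ]
    linarith
  · have h1 : ((n : ℝ) + M) / (n + 1 + M) < 1 := by
      rw [div_lt_one (by positivity)]; linarith
    have := Real.rpow_lt_one (by positivity) h1 (by linarith : 0 < p / 2)
    simp only [μ]
    linarith
  · simp only [hsq]
    have h1 : Summable fun n : ℕ => (((n + M : ℕ) : ℝ) ^ p)⁻¹ :=
      (summable_nat_add_iff (f := fun n : ℕ => ((n : ℝ) ^ p)⁻¹) M).2 (Real.summable_nat_rpow_inv.2 hp)
    refine (h1.mul_left ((M : ℝ) ^ p)).congr fun n => ?_
    rw [Real.div_rpow (by positivity) (by positivity)]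
    push_cast
    rfl
  · rw [hsq, ← Real.mul_rpow (by positivity) (by positivity)]
    refine Real.rpow_le_rpow (by positivity) ?_ hp0.le
    have hn' : (1 : ℝ) ≤ n := by exact_mod_cast hn
    push_cast
    rw [div_mul_eq_mul_div, div_le_div_iff₀ (by positivity) (by positivity)]
    have : 0 ≤ (n - 1) * (M : ℝ) := mul_nonneg (by linarith) hM0.le
    nlinarith

/-! ### Addresses in the source Cantor set. -/

/-- The point with address `a` of the Cantor set with ratios `1/8`. -/
noncomputable def codePoint (a : ℕ → Fin 2 → Bool) : SupPlane :=
  fun i => ∑' j, (1 / 8 : ℝ) ^ j * halfSign (a j i)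

theorem abs_eighth_pow_mul_halfSign (j : ℕ) (b : Bool) :
    |(1 / 8 : ℝ) ^ j * halfSign b| = (1 / 8) ^ j * (1 / 2) := by
  rw [abs_mul, abs_halfSign, abs_of_nonneg (by positivity)]

theorem hasSum_eighth_pow_mul_half :
    HasSum (fun j : ℕ => (1 / 8 : ℝ) ^ j * (1 / 2)) (4 / 7) := by
  have := (hasSum_geometric_of_lt_one (by norm_num : (0 : ℝ) ≤ 1 / 8) (by norm_num)).mul_right
    (1 / 2 : ℝ)
  norm_num at this ⊢
  exact this

theorem summable_codePoint (a : ℕ → Fin 2 → Bool) (i : Fin 2) :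
    Summable fun j => (1 / 8 : ℝ) ^ j * halfSign (a j i) :=
  Summable.of_norm_bounded hasSum_eighth_pow_mul_half.summable
    fun j => (abs_eighth_pow_mul_halfSign j _).le

theorem norm_codePoint_le (a : ℕ → Fin 2 → Bool) : ‖codePoint a‖ ≤ 1 := by
  rw [pi_norm_le_iff_of_nonneg zero_le_one]
  intro i
  have := tsum_of_norm_bounded hasSum_eighth_pow_mul_half
    (f := fun j => (1 / 8 : ℝ) ^ j * halfSign (a j i))
    fun j => (abs_eighth_pow_mul_halfSign j (a j i)).le
  refine this.trans (by norm_num)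

theorem codePoint_eq (a : ℕ → Fin 2 → Bool) :
    codePoint a = corner (a 0) + (1 / 8 : ℝ) • codePoint fun j => a (j + 1) := by
  ext i
  simp only [codePoint, Pi.add_apply, Pi.smul_apply, smul_eq_mul, corner]
  rw [(summable_codePoint a i).tsum_eq_zero_add, ← tsum_mul_left]
  simp only [pow_zero, one_mul, pow_succ']
  congr 1
  exact tsum_congr fun j => by ring

theorem continuous_codePoint : Continuous codePoint := by
  refine continuous_pi fun i => continuous_tsum (fun j => ?_)
    hasSum_eighth_pow_mul_half.summable fun j a => (abs_eighth_pow_mul_halfSign j _).le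
  have h : Continuous halfSign := continuous_of_discreteTopology
  exact continuous_const.mul (h.comp (by fun_prop : Continuous fun a : ℕ → Fin 2 → Bool => a j i))

theorem codePoint_mem_levelSet (n : ℕ) (a : ℕ → Fin 2 → Bool) : codePoint a ∈ levelSet n := by
  induction n generalizing a with
  | zero => simpa [levelSet] using norm_codePoint_le a
  | succ n ih =>
    refine Set.mem_iUnion.2 ⟨a 0, ?_⟩
    rw [Set.mem_ofPred_eq, codePoint_eq a, add_sub_cancel_left, smul_smul]
    norm_num [ih]

/-- The Cantor set is a Lipschitz graph over its projection in the direction `(1, 2)`. -/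
theorem dist_codePoint_le (a b : ℕ → Fin 2 → Bool) :
    dist (codePoint a) (codePoint b) ≤
      8 * |(codePoint a 0 + 2 * codePoint a 1) - (codePoint b 0 + 2 * codePoint b 1)| := by
  -- A common first digit scales both sides by `1 / 8`; the error `2 / 8 ^ n` starts the induction
  -- and vanishes in the limit.
  have key : ∀ n : ℕ, ∀ a b : ℕ → Fin 2 → Bool, dist (codePoint a) (codePoint b) ≤
      8 * |(codePoint a 0 + 2 * codePoint a 1) - (codePoint b 0 + 2 * codePoint b 1)|
        + 2 / 8 ^ n := by
    intro n
    induction n with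
    | zero =>
      intro a b
      have h1 := dist_le_norm_add_norm (codePoint a) (codePoint b)
      have h2 := abs_nonneg
        ((codePoint a 0 + 2 * codePoint a 1) - (codePoint b 0 + 2 * codePoint b 1))
      norm_num
      linarith [norm_codePoint_le a, norm_codePoint_le b]
    | succ n ih =>
      intro a b
      have ih' := ih (fun j => a (j + 1)) (fun j => b (j + 1))
      rw [codePoint_eq a, codePoint_eq b]
      set v := codePoint fun j => a (j + 1)
      set w := codePoint fun j => b (j + 1)
      have hv : ‖v‖ ≤ 1 := norm_codePoint_le _
      have hw : ‖w‖ ≤ 1 := norm_codePoint_le _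
      by_cases h : a 0 = b 0
      · rw [h, dist_add_left, dist_smul₀]
        simp only [Pi.add_apply, Pi.smul_apply, smul_eq_mul]
        have e : (corner (b 0) 0 + 1 / 8 * v 0 + 2 * (corner (b 0) 1 + 1 / 8 * v 1) -
            (corner (b 0) 0 + 1 / 8 * w 0 + 2 * (corner (b 0) 1 + 1 / 8 * w 1))) =
            1 / 8 * ((v 0 + 2 * v 1) - (w 0 + 2 * w 1)) := by ring
        rw [e, abs_mul, abs_of_nonneg (by norm_num : (0 : ℝ) ≤ 1 / 8),
          Real.norm_of_nonneg (by norm_num), pow_succ, ← div_div]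
        linarith
      · have hv0 := abs_le.1 ((norm_le_pi_norm v 0).trans hv)
        have hv1 := abs_le.1 ((norm_le_pi_norm v 1).trans hv)
        have hw0 := abs_le.1 ((norm_le_pi_norm w 0).trans hw)
        have hw1 := abs_le.1 ((norm_le_pi_norm w 1).trans hw)
        have hd : dist (corner (a 0) + (1 / 8 : ℝ) • v) (corner (b 0) + (1 / 8 : ℝ) • w) ≤ 2 := by
          refine (dist_le_norm_add_norm _ _).trans ?_
          have h1 := norm_corner_add_le (b := a 0) (w := (1 / 8 : ℝ) • v)
            (by rw [norm_eighth_smul]; linarith)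
          have h2 := norm_corner_add_le (b := b 0) (w := (1 / 8 : ℝ) • w)
            (by rw [norm_eighth_smul]; linarith)
          linarith
        have h8 : (0 : ℝ) ≤ 2 / 8 ^ (n + 1) := by positivity
        -- In the direction `(1, 2)` the four centres project to `±1 / 2` and `±3 / 2`, at spacing
        -- `1`, and each child has half-width at most `3 / 8`. The gaps are thus at least `1 / 4`,
        -- and the total distance is at most `2 = 8 * (1 / 4)`.
        have hsep : 1 / 4 ≤ |((corner (a 0) + (1 / 8 : ℝ) • v) 0 +
            2 * (corner (a 0) + (1 / 8 : ℝ) • v) 1) - ((corner (b 0) + (1 / 8 : ℝ) • w) 0 +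
            2 * (corner (b 0) + (1 / 8 : ℝ) • w) 1)| := by
          have hne : a 0 0 ≠ b 0 0 ∨ a 0 1 ≠ b 0 1 := by
            by_contra hc
            push Not at hc
            exact h (funext fun i => by fin_cases i; exacts [hc.1, hc.2])
          simp only [Pi.add_apply, Pi.smul_apply, smul_eq_mul, corner, halfSign]
          rw [le_abs]
          cases ha0 : a 0 0 <;> cases ha1 : a 0 1 <;> cases hb0 : b 0 0 <;> cases hb1 : b 0 1 <;>
            simp [ha0, ha1, hb0, hb1] at hne ⊢ <;>
            first
              | (left; linarith)
              | (right; linarith)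
        linarith
  refine ge_of_tendsto' (x := atTop) (f := fun n : ℕ => 8 * |(codePoint a 0 + 2 * codePoint a 1) -
    (codePoint b 0 + 2 * codePoint b 1)| + 2 / 8 ^ n) ?_ fun n => key n a b
  have : Tendsto (fun n : ℕ => (2 : ℝ) / 8 ^ n) atTop (𝓝 0) :=
    tendsto_const_nhds.div_atTop (tendsto_pow_atTop_atTop_of_one_lt (by norm_num))
  simpa using this.const_add _

theorem codePoint_injective : Function.Injective codePoint := by
  have key : ∀ n : ℕ, ∀ a b : ℕ → Fin 2 → Bool, codePoint a = codePoint b → a n = b n := by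
    have h0 : ∀ a b : ℕ → Fin 2 → Bool, codePoint a = codePoint b → a 0 = b 0 := by
      intro a b h
      rw [codePoint_eq a, codePoint_eq b] at h
      ext i
      have hi := congrFun h i
      have ha := abs_le.1 ((norm_le_pi_norm _ i).trans (norm_codePoint_le fun j => a (j + 1)))
      have hb := abs_le.1 ((norm_le_pi_norm _ i).trans (norm_codePoint_le fun j => b (j + 1)))
      simp only [Pi.add_apply, Pi.smul_apply, smul_eq_mul, corner, halfSign] at hi
      cases h1 : a 0 i <;> cases h2 : b 0 i <;> simp [h1, h2] at hi ⊢ <;> linarith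
    intro n
    induction n with
    | zero => exact h0
    | succ n ih =>
      intro a b h
      refine ih (fun j => a (j + 1)) (fun j => b (j + 1)) ?_
      have h1 := h0 a b h
      rw [codePoint_eq a, codePoint_eq b, h1] at h
      exact smul_right_injective _ (by norm_num : (1 / 8 : ℝ) ≠ 0) (add_left_cancel h)
  exact fun a b h => funext fun n => key n a b h

/-- The Cantor set with ratios `1/8`. -/
def cantorDust : Set SupPlane := Set.range codePoint

theorem isCompact_cantorDust : IsCompact cantorDust := isCompact_range continuous_codePoint

/-- Interleaving the two digit sequences turns addresses into binary sequences. A continuous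
injection from a compact space to a Hausdorff one is an embedding. -/
theorem isCantorSet_image_cantorDust {X : Type*} [TopologicalSpace X] (e : SupPlane ≃ₜ X) :
    IsCantorSet (e '' cantorDust) := by
  have hr : Function.Bijective fun (c : ℕ → Bool) (j : ℕ) (i : Fin 2) =>
      c ((Nat.divModEquiv 2).symm (j, i)) := by
    refine ⟨fun c c' h => funext fun m => ?_,
      fun a => ⟨fun m => a (Nat.divModEquiv 2 m).1 (Nat.divModEquiv 2 m).2, ?_⟩⟩
    · have := congrFun (congrFun h (Nat.divModEquiv 2 m).1) (Nat.divModEquiv 2 m).2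
      simpa only [Prod.mk.eta, Equiv.symm_apply_apply] using this
    · funext j i
      simp only [Equiv.apply_symm_apply]
  have hc : Continuous fun (c : ℕ → Bool) (j : ℕ) (i : Fin 2) =>
      c ((Nat.divModEquiv 2).symm (j, i)) :=
    continuous_pi fun j => continuous_pi fun i => continuous_apply _
  have hemb := e.isClosedEmbedding.comp
    ((continuous_codePoint.comp hc).isClosedEmbedding (codePoint_injective.comp hr.1))
  have hrange : Set.range (e ∘ codePoint ∘ fun (c : ℕ → Bool) (j : ℕ) (i : Fin 2) =>
      c ((Nat.divModEquiv 2).symm (j, i))) = e '' cantorDust := by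
    rw [Set.range_comp, Set.range_comp, hr.2.range_eq, Set.image_univ, cantorDust]
  rw [← hrange]
  exact ⟨hemb.isEmbedding.toHomeomorph.symm⟩

/-- Iterating `limitMap_corner_add` extracts `n` digits; the remainder is a point of the unit ball
scaled by the product of the ratios. -/
theorem abs_limitMap_codePoint_sub_le {μ : ℕ → ℝ} (hμ : AdmissibleRatios μ) (n : ℕ)
    (a : ℕ → Fin 2 → Bool) (i : Fin 2) :
    |limitMap μ (codePoint a) i -
      ∑ j ∈ Finset.range n, (∏ k ∈ Finset.range j, μ k) * halfSign (a j i)| ≤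
      ∏ k ∈ Finset.range n, μ k := by
  induction n generalizing μ a with
  | zero =>
    simpa using (norm_le_pi_norm _ i).trans
      ((unitBallMap_limitMap hμ).norm_le _ (norm_codePoint_le a))
  | succ n ih =>
    have h := ih hμ.shift fun j => a (j + 1)
    have hm : 0 ≤ μ 0 := by linarith [(hμ 0).1]
    rw [codePoint_eq a, limitMap_corner_add hμ _ (norm_codePoint_le _), Finset.sum_range_succ',
      Finset.prod_range_succ']
    have e : (corner (a 0) + μ 0 • limitMap (fun k => μ (k + 1)) (codePoint fun j => a (j + 1))) i
        - (∑ j ∈ Finset.range n, (∏ k ∈ Finset.range (j + 1), μ k) * halfSign (a (j + 1) i)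
          + (∏ k ∈ Finset.range 0, μ k) * halfSign (a 0 i)) =
        (limitMap (fun k => μ (k + 1)) (codePoint fun j => a (j + 1)) i -
          ∑ j ∈ Finset.range n, (∏ k ∈ Finset.range j, μ (k + 1)) * halfSign (a (j + 1) i))
          * μ 0 := by
      rw [sub_mul, Finset.sum_mul]
      simp only [Finset.prod_range_succ', Pi.add_apply, Pi.smul_apply, smul_eq_mul, corner,
        Finset.prod_range_zero, one_mul]
      rw [Finset.sum_congr rfl fun j _ => mul_right_comm _ (μ 0) _]
      ring
    rw [e, abs_mul, abs_of_nonneg hm]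
    exact mul_le_mul_of_nonneg_right h hm

/-! ### Separation of points of the target Cantor set by binary digits. -/

/-- The `j`-th binary digit of `t`. -/
noncomputable def binaryDigit (t : ℝ) (j : ℕ) : Bool := decide (⌊2 ^ (j + 1) * t⌋ % 2 = 1)

theorem halfSign_binaryDigit (t : ℝ) (j : ℕ) :
    halfSign (binaryDigit t j) = (⌊2 ^ (j + 1) * t⌋ : ℝ) - 2 * ⌊2 ^ j * t⌋ - 1 / 2 := by
  have h : ⌊2 ^ (j + 1) * t⌋ = 2 * ⌊2 ^ j * t⌋ ∨ ⌊2 ^ (j + 1) * t⌋ = 2 * ⌊2 ^ j * t⌋ + 1 := by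
    rw [pow_succ', mul_assoc]
    set x := 2 ^ j * t
    have h1 : 2 * ⌊x⌋ ≤ ⌊2 * x⌋ := by
      rw [Int.le_floor]; push_cast; linarith [Int.floor_le x]
    have h2 : ⌊2 * x⌋ < 2 * ⌊x⌋ + 2 := by
      rw [Int.floor_lt]; push_cast; linarith [Int.lt_floor_add_one x]
    omega
  rcases h with h | h <;> rw [binaryDigit, halfSign, h]
  · rw [show 2 * ⌊2 ^ j * t⌋ % 2 = 0 by omega]
    push_cast
    norm_num
  · rw [show (2 * ⌊2 ^ j * t⌋ + 1) % 2 = 1 by omega]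
    push_cast
    norm_num

theorem AdmissibleRatios.prod_pos {μ : ℕ → ℝ} (hμ : AdmissibleRatios μ) (n : ℕ) :
    0 < ∏ k ∈ Finset.range n, μ k :=
  Finset.prod_pos fun k _ => by linarith [(hμ k).1]

/-- With `Δ n` the difference of the floors at scale `n` and `Q n` the product of the ratios, the
new digits add `Q n * (Δ (n + 1) - 2 * Δ n)`. The induction thus yields `Q n * Δ (n + 1)`, which is
at least `2 * Q (n + 1) * Δ (n + 1)` because `2 * μ n < 1`. -/
theorem le_sum_binaryDigit_sub {μ : ℕ → ℝ} (hμ : AdmissibleRatios μ) {s t : ℝ} (hs : 0 ≤ s)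
    (hst : s ≤ t) (ht : t < 1) (n : ℕ) :
    2 * (∏ k ∈ Finset.range n, μ k) * (⌊2 ^ n * t⌋ - ⌊2 ^ n * s⌋) ≤
      ∑ j ∈ Finset.range n, (∏ k ∈ Finset.range j, μ k) * halfSign (binaryDigit t j) -
      ∑ j ∈ Finset.range n, (∏ k ∈ Finset.range j, μ k) * halfSign (binaryDigit s j) := by
  induction n with
  | zero =>
    have h1 : ⌊t⌋ = 0 := Int.floor_eq_zero_iff.2 ⟨hs.trans hst, ht⟩
    have h2 : ⌊s⌋ = 0 := Int.floor_eq_zero_iff.2 ⟨hs, hst.trans_lt ht⟩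
    simp [h1, h2]
  | succ n ih =>
    rw [Finset.sum_range_succ, Finset.sum_range_succ, halfSign_binaryDigit, halfSign_binaryDigit,
      Finset.prod_range_succ]
    have hp := hμ.prod_pos n
    have hN : (⌊2 ^ (n + 1) * s⌋ : ℝ) ≤ ⌊2 ^ (n + 1) * t⌋ := by
      exact_mod_cast Int.floor_le_floor (by gcongr)
    set P := ∏ k ∈ Finset.range n, μ k
    set a : ℝ := ((⌊2 ^ (n + 1) * t⌋ : ℤ) : ℝ)
    set b : ℝ := ((⌊2 ^ (n + 1) * s⌋ : ℤ) : ℝ)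
    have h3 : P * (1 - 2 * μ n) * (a - b) ≥ 0 :=
      mul_nonneg (mul_nonneg hp.le (by linarith [(hμ n).2])) (by linarith)
    linarith

/-- The point of the Cantor set with ratios `μ` whose address is given by the binary digits of the
coordinates of `t`. -/
noncomputable def digitPoint (μ : ℕ → ℝ) (t : SupPlane) : SupPlane :=
  limitMap μ (codePoint fun j i => binaryDigit (t i) j)

/-- In each coordinate, truncating both expansions costs at most another `2 * ∏ μ k`. The gap is
then below twice the interval length, so the parameters lie in equal or adjacent dyadic intervals.
-/
theorem dist_le_of_dist_digitPoint_lt {μ : ℕ → ℝ} (hμ : AdmissibleRatios μ) {n : ℕ}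
    {s t : SupPlane} (hs : ∀ i, s i ∈ Set.Ico (0 : ℝ) 1) (ht : ∀ i, t i ∈ Set.Ico (0 : ℝ) 1)
    (h : dist (digitPoint μ s) (digitPoint μ t) < 2 * ∏ k ∈ Finset.range n, μ k) :
    dist s t ≤ 2 / 2 ^ n := by
  refine (dist_pi_le_iff (by positivity)).2 fun i => ?_
  have hi := (dist_le_pi_dist _ _ i).trans_lt h
  clear h
  wlog hst : s i ≤ t i generalizing s t
  · rw [dist_comm]
    exact this ht hs (by rwa [dist_comm]) (le_of_not_ge hst)
  have h1 := abs_le.1 (abs_limitMap_codePoint_sub_le hμ n (fun j i => binaryDigit (s i) j) i)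
  have h2 := abs_le.1 (abs_limitMap_codePoint_sub_le hμ n (fun j i => binaryDigit (t i) j) i)
  have h3 := le_sum_binaryDigit_sub hμ (hs i).1 hst (ht i).2 n
  rw [dist_comm, Real.dist_eq] at hi ⊢
  have h4 := (abs_lt.1 hi).2
  simp only [digitPoint] at h4
  have hp := hμ.prod_pos n
  have h5 : ((⌊2 ^ n * t i⌋ - ⌊2 ^ n * s i⌋ : ℤ) : ℝ) < (2 : ℤ) := by
    push_cast
    by_contra hc
    push Not at hc
    nlinarith
  have h6 : ⌊2 ^ n * t i⌋ - ⌊2 ^ n * s i⌋ ≤ 1 := by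
    have := Int.cast_lt.1 h5; omega
  have h7 : (⌊2 ^ n * t i⌋ : ℝ) - ⌊2 ^ n * s i⌋ ≤ 1 := by exact_mod_cast h6
  rw [abs_of_nonneg (by linarith), le_div_iff₀ (by positivity)]
  linarith [Int.floor_le (2 ^ n * s i), Int.lt_floor_add_one (2 ^ n * t i)]

theorem measurable_digitPoint {μ : ℕ → ℝ} (hμ : AdmissibleRatios μ) :
    Measurable (digitPoint μ) := by
  refine (continuous_limitMap hμ).measurable.comp (continuous_codePoint.measurable.comp ?_)
  refine measurable_pi_lambda _ fun j => measurable_pi_lambda _ fun i => ?_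
  have h : Measurable fun t : SupPlane => ⌊(2 : ℝ) ^ (j + 1) * t i⌋ :=
    Int.measurable_floor.comp ((measurable_pi_apply i).const_mul _)
  exact (measurable_of_countable fun m : ℤ => decide (m % 2 = 1)).comp h

/-! ### Hausdorff measure of the source and of the image. -/

/-- One factor `d` absorbs the logarithm: `d ^ (1 / p) * log (1 / d)` is less than `p`, and the
constant is the `p`-th power of this bound. -/
theorem logGauge_le {p : ℝ} (hp : 0 < p) {d : ℝ} (h0 : 0 ≤ d) (h1 : d ≤ 1) :
    logGauge p d ≤ p ^ p * d := by
  rcases h0.eq_or_lt with rfl | h0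
  · simp [logGauge]
  · have hlog : 0 ≤ Real.log (1 / d) := Real.log_nonneg (by rwa [le_div_iff₀ h0, one_mul])
    have h := Real.abs_log_mul_self_rpow_lt d (1 / p) h0 h1 (by positivity)
    rw [one_div_one_div, abs_mul, abs_of_pos (Real.rpow_pos_of_pos h0 _),
      abs_of_nonpos (Real.log_nonpos h0.le h1), ← Real.log_inv, ← one_div] at h
    have h2 := Real.rpow_le_rpow (by positivity) h.le hp.le
    rw [Real.mul_rpow hlog (by positivity), ← Real.rpow_mul h0.le, one_div_mul_cancel hp.ne',
      Real.rpow_one] at h2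
    rw [logGauge]
    nlinarith

/-- The dust has dimension `2 / 3 < 1`. Comparing the gauge with the diameter, the natural covers
have sum of order `4 ^ n / 8 ^ n`, which tends to `0`. -/
theorem logHausdorffMeasure_cantorDust {p : ℝ} (hp : 0 < p) :
    logHausdorffMeasure p (squareChart '' cantorDust) = 0 := by
  choose P hPc hP using exists_levelSet_cover
  let T : ∀ n : ℕ, P n → Set (EuclideanSpace ℝ (Fin 2)) :=
    fun n y => squareChart '' Metric.closedBall (y : SupPlane) (1 / 8 ^ n)
  have hdiam : ∀ n (y : P n), Metric.ediam (T n y) ≤ ENNReal.ofReal (2 / 8 ^ n) := by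
    intro n y
    refine Metric.ediam_le ?_
    rintro _ ⟨v, hv, rfl⟩ _ ⟨w, hw, rfl⟩
    rw [edist_dist]
    apply ENNReal.ofReal_le_ofReal
    have := dist_squareChart_le v w
    have h2 := dist_triangle_right v w (y : SupPlane)
    rw [Metric.mem_closedBall] at hv hw
    have e : (2 : ℝ) / 8 ^ n = 1 / 8 ^ n + 1 / 8 ^ n := by ring
    linarith
  have hr : Tendsto (fun n : ℕ => ENNReal.ofReal (2 / 8 ^ n)) atTop (𝓝 0) := by
    rw [← ENNReal.ofReal_zero]
    exact ENNReal.tendsto_ofReal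
      (tendsto_const_nhds.div_atTop (tendsto_pow_atTop_atTop_of_one_lt (by norm_num)))
  have hcov : ∀ n, squareChart '' cantorDust ⊆ ⋃ y, T n y := by
    rintro n _ ⟨_, ⟨a, rfl⟩, rfl⟩
    obtain ⟨y, hy, hd⟩ := hP n _ (codePoint_mem_levelSet n a)
    exact Set.mem_iUnion.2 ⟨⟨y, hy⟩, Set.mem_image_of_mem _ hd⟩
  have hsum : ∀ᶠ n : ℕ in atTop, ∑ y, ENNReal.ofReal (logGauge p (Metric.ediam (T n y)).toReal) ≤
      ENNReal.ofReal (p ^ p * 2 / 2 ^ n) := by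
    filter_upwards [eventually_ge_atTop 1] with n hn
    have h8 : (2 : ℝ) / 8 ^ n ≤ 1 := by
      rw [div_le_one (by positivity)]
      calc (2 : ℝ) ≤ 8 ^ 1 := by norm_num
        _ ≤ 8 ^ n := pow_le_pow_right₀ (by norm_num) hn
    have hpiece : ∀ y, ENNReal.ofReal (logGauge p (Metric.ediam (T n y)).toReal) ≤
        ENNReal.ofReal (p ^ p * (2 / 8 ^ n)) := by
      intro y
      have hd : (Metric.ediam (T n y)).toReal ≤ 2 / 8 ^ n :=
        ENNReal.toReal_le_of_le_ofReal (by positivity) (hdiam n y)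
      apply ENNReal.ofReal_le_ofReal
      refine (logGauge_le hp ENNReal.toReal_nonneg (hd.trans h8)).trans ?_
      gcongr
    refine (Finset.sum_le_sum fun y _ => hpiece y).trans ?_
    rw [Finset.sum_const, nsmul_eq_mul, ← ENNReal.ofReal_natCast,
      ← ENNReal.ofReal_mul (by positivity)]
    apply ENNReal.ofReal_le_ofReal
    have hc : ((Finset.univ : Finset (P n)).card : ℝ) ≤ 4 ^ n := by
      rw [Finset.card_univ, Fintype.card_coe]
      exact_mod_cast hPc n
    calc ((Finset.univ : Finset (P n)).card : ℝ) * (p ^ p * (2 / 8 ^ n))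
        ≤ 4 ^ n * (p ^ p * (2 / 8 ^ n)) := by gcongr
      _ = p ^ p * 2 / 2 ^ n := by
        rw [show (8 : ℝ) ^ n = 4 ^ n * 2 ^ n by rw [← mul_pow]; norm_num]
        field_simp
  have hlim : Tendsto (fun n : ℕ => ENNReal.ofReal (p ^ p * 2 / 2 ^ n)) atTop (𝓝 0) := by
    rw [← ENNReal.ofReal_zero]
    exact ENNReal.tendsto_ofReal
      (tendsto_const_nhds.div_atTop (tendsto_pow_atTop_atTop_of_one_lt one_lt_two))
  refine le_antisymm ?_ zero_le
  rw [logHausdorffMeasure]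
  refine (Measure.mkMetric_le_liminf_sum _ _ hr T (Eventually.of_forall hdiam)
    (Eventually.of_forall hcov) _).trans ?_
  rw [← hlim.liminf_eq]
  exact liminf_le_liminf hsum

/-- The unit square as a subset of `SupPlane`. -/
def unitBox : Set SupPlane := Set.pi Set.univ fun _ => Set.Ico (0 : ℝ) 1

theorem volume_unitBox : volume unitBox = 1 := by
  rw [unitBox, Real.volume_pi_Ico]
  simp

theorem prod_eq_div_two_pow (μ : ℕ → ℝ) (n : ℕ) :
    ∏ k ∈ Finset.range n, μ k = (∏ k ∈ Finset.range n, (2 * μ k)) / 2 ^ n := by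
  rw [Finset.prod_mul_distrib, Finset.prod_const, Finset.card_range]
  field_simp

theorem AdmissibleRatios.prod_le {μ : ℕ → ℝ} (hμ : AdmissibleRatios μ) (n : ℕ) :
    ∏ k ∈ Finset.range n, μ k ≤ 1 / 2 ^ n := by
  rw [prod_eq_div_two_pow]
  gcongr
  exact Finset.prod_le_one (fun k _ => by linarith [(hμ k).1]) fun k _ => by linarith [(hμ k).2]

theorem volume_le_of_dist_digitPoint {μ : ℕ → ℝ} (hμ : AdmissibleRatios μ) {S : Set SupPlane}
    (hS : S ⊆ unitBox) {d : ℝ}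
    (hd : ∀ s ∈ S, ∀ t ∈ S, dist (digitPoint μ s) (digitPoint μ t) ≤ 2 * d) {n : ℕ}
    (hn : d < ∏ k ∈ Finset.range n, μ k) : volume S ≤ ENNReal.ofReal (4 / 4 ^ n) := by
  have h1 : Metric.ediam S ≤ ENNReal.ofReal (2 / 2 ^ n) := by
    refine Metric.ediam_le fun s hs t ht => ?_
    rw [edist_dist]
    apply ENNReal.ofReal_le_ofReal
    refine dist_le_of_dist_digitPoint_lt hμ (fun i => hS hs i trivial) (fun i => hS ht i trivial) ?_
    linarith [hd s hs t ht]
  refine (Real.volume_pi_le_diam_pow S).trans ?_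
  rw [Fintype.card_fin]
  refine (pow_le_pow_left₀ zero_le h1 2).trans ?_
  rw [← ENNReal.ofReal_pow (by positivity)]
  apply ENNReal.ofReal_le_ofReal
  rw [div_pow, ← pow_mul, mul_comm n, pow_mul]
  norm_num

/-- Lower bound for the gauge at scale `n` of the Cantor set with ratios `μ`. -/
theorem le_logGauge {p : ℝ} (hp : 0 < p) {μ : ℕ → ℝ} (hμ : AdmissibleRatios μ) {c : ℝ}
    {n : ℕ} (hc : c ≤ (∏ j ∈ Finset.range (n + 1), (2 * μ j)) ^ 2 * (n : ℝ) ^ p)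
    {d : ℝ} (h1 : ∏ k ∈ Finset.range (n + 1), μ k ≤ d) (h2 : d < ∏ k ∈ Finset.range n, μ k) :
    c * Real.log 2 ^ p / 16 * (4 / 4 ^ n) ≤ logGauge p d := by
  have hρ := hμ.prod_pos (n + 1)
  have hd : 0 < d := hρ.trans_le h1
  have hlog2 : 0 < Real.log 2 := Real.log_pos one_lt_two
  have hlog : n * Real.log 2 ≤ Real.log (1 / d) := by
    rw [← Real.log_pow]
    apply Real.log_le_log (by positivity)
    rw [le_one_div (by positivity) hd]
    exact h2.le.trans (hμ.prod_le n)
  have h3 : (n * Real.log 2) ^ p ≤ Real.log (1 / d) ^ p :=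
    Real.rpow_le_rpow (by positivity) hlog hp.le
  have h4 : (∏ k ∈ Finset.range (n + 1), μ k) ^ 2 ≤ d ^ 2 := pow_le_pow_left₀ hρ.le h1 2
  rw [logGauge]
  calc c * Real.log 2 ^ p / 16 * (4 / 4 ^ n)
      ≤ (∏ j ∈ Finset.range (n + 1), (2 * μ j)) ^ 2 * (n : ℝ) ^ p * Real.log 2 ^ p / 16
          * (4 / 4 ^ n) := by gcongr
    _ = (∏ k ∈ Finset.range (n + 1), μ k) ^ 2 * (n * Real.log 2) ^ p := by
        rw [Real.mul_rpow (by positivity) hlog2.le, prod_eq_div_two_pow μ (n + 1), div_pow, ← pow_mul,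
          mul_comm (n + 1) 2, pow_mul, pow_succ (2 ^ 2)]
        norm_num
        field_simp
        norm_num
    _ ≤ d ^ 2 * Real.log (1 / d) ^ p := by gcongr

/-- Mass distribution principle: Lebesgue measure on the unit square, transported by binary digits,
is supported on the image set, and on sets of small diameter it is bounded by a multiple of the
gauge. -/
theorem logHausdorffMeasure_image_pos {p : ℝ} (hp : 0 < p) {μ : ℕ → ℝ} (hμ : AdmissibleRatios μ)
    {c : ℝ} (hc0 : 0 < c)
    (hc : ∀ n : ℕ, 1 ≤ n → c ≤ (∏ j ∈ Finset.range (n + 1), (2 * μ j)) ^ 2 * (n : ℝ) ^ p) :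
    0 < logHausdorffMeasure p (squareChart '' (limitMap μ '' cantorDust)) := by
  have hlog2 : 0 < Real.log 2 := Real.log_pos one_lt_two
  set κ := c * Real.log 2 ^ p / 16 with hκ
  have hκ0 : 0 < κ := by positivity
  let Y : SupPlane → EuclideanSpace ℝ (Fin 2) := fun t => squareChart (digitPoint μ t)
  have hY : Measurable Y := squareChart.continuous.measurable.comp (measurable_digitPoint hμ)
  let ν : Measure (EuclideanSpace ℝ (Fin 2)) := (volume.restrict unitBox).map Y
  have hle : ENNReal.ofReal κ • ν ≤ logHausdorffMeasure p := by
    -- The threshold `1 / 8` lies below `μ 0 ≥ 1 / 4`, so the generation matching the diameter has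
    -- index at least `1`, as `hc` requires.
    refine Measure.le_mkMetric _ _ (ENNReal.ofReal (1 / 8)) (by simp) fun S hS => ?_
    have hSt : Metric.ediam S ≠ ⊤ := ne_top_of_le_ne_top ENNReal.ofReal_ne_top hS
    set d := (Metric.ediam S).toReal with hd
    have hd8 : d ≤ 1 / 8 := ENNReal.toReal_le_of_le_ofReal (by norm_num) hS
    -- Passing to the closure gives a measurable set without changing the diameter.
    have hνS : ν S ≤ volume (Y ⁻¹' closure S ∩ unitBox) := by
      refine (measure_mono subset_closure).trans ?_
      rw [Measure.map_apply hY isClosed_closure.measurableSet,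
        Measure.restrict_apply (hY isClosed_closure.measurableSet)]
    have hdist : ∀ s ∈ Y ⁻¹' closure S ∩ unitBox, ∀ t ∈ Y ⁻¹' closure S ∩ unitBox,
        dist (digitPoint μ s) (digitPoint μ t) ≤ 2 * d := by
      intro s hs t ht
      refine (dist_le_two_mul_dist_squareChart _ _).trans ?_
      have h1 : edist (Y s) (Y t) ≤ Metric.ediam (closure S) := Metric.edist_le_ediam_of_mem hs.1 ht.1
      rw [Metric.ediam_closure] at h1
      rw [dist_edist]
      gcongr
      exact ENNReal.toReal_mono hSt h1
    have hvol : ∀ n, d < ∏ k ∈ Finset.range n, μ k → ν S ≤ ENNReal.ofReal (4 / 4 ^ n) :=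
      fun n hn => hνS.trans (volume_le_of_dist_digitPoint hμ Set.inter_subset_right hdist hn)
    rw [Measure.smul_apply, smul_eq_mul]
    rcases (ENNReal.toReal_nonneg : 0 ≤ d).eq_or_lt with h0 | h0
    · have hlim : Tendsto (fun n : ℕ => ENNReal.ofReal (4 / 4 ^ n)) atTop (𝓝 0) := by
        rw [← ENNReal.ofReal_zero]
        exact ENNReal.tendsto_ofReal
          (tendsto_const_nhds.div_atTop (tendsto_pow_atTop_atTop_of_one_lt (by norm_num)))
      have : ν S = 0 := le_antisymm
        (ge_of_tendsto' hlim fun n => hvol n (h0.symm.trans_lt (hμ.prod_pos n))) zero_le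
      rw [this, mul_zero]
      exact zero_le
    · have hex : ∃ n, ∏ k ∈ Finset.range (n + 1), μ k ≤ d := by
        obtain ⟨n, hn⟩ := exists_pow_lt_of_lt_one h0 (by norm_num : (1 / 2 : ℝ) < 1)
        refine ⟨n, (hμ.prod_le (n + 1)).trans (le_trans ?_ hn.le)⟩
        rw [one_div_pow]
        exact one_div_le_one_div_of_le (by positivity)
          (pow_le_pow_right₀ (by norm_num) (Nat.le_succ n))
      classical
      obtain ⟨n, hn, hmin⟩ : ∃ n, ∏ k ∈ Finset.range (n + 1), μ k ≤ d ∧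
          ∀ m < n, ¬ ∏ k ∈ Finset.range (m + 1), μ k ≤ d :=
        ⟨Nat.find hex, Nat.find_spec hex, fun m hm => Nat.find_min hex hm⟩
      cases n with
      | zero =>
        simp only [zero_add, Finset.prod_range_one] at hn
        linarith [(hμ 0).1]
      | succ n =>
        have hn2 := not_le.1 (hmin n (Nat.lt_succ_self n))
        refine (mul_le_mul_right (hvol (n + 1) hn2) _).trans ?_
        rw [← ENNReal.ofReal_mul hκ0.le]
        exact ENNReal.ofReal_le_ofReal (le_logGauge hp hμ (hc _ (by omega)) hn hn2)
  refine lt_of_lt_of_le ?_ (hle _)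
  have hcl : MeasurableSet (squareChart '' (limitMap μ '' cantorDust)) :=
    ((isCompact_cantorDust.image (continuous_limitMap hμ)).image
      squareChart.continuous).isClosed.measurableSet
  have huniv : Y ⁻¹' (squareChart '' (limitMap μ '' cantorDust)) = Set.univ :=
    Set.eq_univ_of_forall fun t => Set.mem_image_of_mem _
      (Set.mem_image_of_mem _ (Set.mem_range_self _))
  rw [Measure.smul_apply, Measure.map_apply hY hcl, huniv, Measure.restrict_apply_univ,
    volume_unitBox, smul_eq_mul, mul_one]
  exact ENNReal.ofReal_pos.2 hκ0

/-! ### Placing the Cantor set on a bi-Lipschitz image of the circle. -/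

theorem abs_sqrt_one_sub_sq_sub_le {x y : ℝ} (hx : |x| ≤ 1 / 2) (hy : |y| ≤ 1 / 2) :
    |√(1 - x ^ 2) - √(1 - y ^ 2)| ≤ |x - y| := by
  have hx' := abs_le.1 hx
  have hy' := abs_le.1 hy
  have h1 : (0 : ℝ) ≤ 1 - x ^ 2 := by nlinarith
  have h2 : (0 : ℝ) ≤ 1 - y ^ 2 := by nlinarith
  have ha : 1 / 2 ≤ √(1 - x ^ 2) := Real.le_sqrt_of_sq_le (by nlinarith)
  have hb : 1 / 2 ≤ √(1 - y ^ 2) := Real.le_sqrt_of_sq_le (by nlinarith)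
  have e : (√(1 - x ^ 2) - √(1 - y ^ 2)) * (√(1 - x ^ 2) + √(1 - y ^ 2)) = (y - x) * (x + y) := by
    have h3 := Real.sq_sqrt h1
    have h4 := Real.sq_sqrt h2
    linear_combination h3 - h4
  have e' := congrArg abs e
  rw [abs_mul, abs_mul, abs_of_nonneg (by linarith : 0 ≤ √(1 - x ^ 2) + √(1 - y ^ 2)),
    abs_sub_comm y x] at e'
  have h5 : |x + y| ≤ 1 := by rw [abs_le]; constructor <;> linarith
  nlinarith [abs_nonneg (√(1 - x ^ 2) - √(1 - y ^ 2)), abs_nonneg (x - y)]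

/-- The Cantor set lies on the image of the unit circle under a bi-Lipschitz shear. -/
theorem exists_shear : ∃ (Φ : ℝ → ℝ) (K : ℝ≥0), LipschitzWith K Φ ∧ ∀ a,
    ((codePoint a 0 + 2 * codePoint a 1) / 6) ^ 2 +
      (codePoint a 1 - Φ ((codePoint a 0 + 2 * codePoint a 1) / 6)) ^ 2 = 1 := by
  classical
  -- Division by `6` brings the projection into `[-1 / 2, 1 / 2]`, where the upper arc of the circle
  -- is a Lipschitz graph.
  let q : (ℕ → Fin 2 → Bool) → ℝ := fun a => (codePoint a 0 + 2 * codePoint a 1) / 6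
  have hq : ∀ a, |q a| ≤ 1 / 2 := by
    intro a
    have h0 := abs_le.1 ((norm_le_pi_norm _ 0).trans (norm_codePoint_le a))
    have h1 := abs_le.1 ((norm_le_pi_norm _ 1).trans (norm_codePoint_le a))
    simp only [q]
    rw [abs_le]; constructor <;> linarith
  let r : (ℕ → Fin 2 → Bool) → ℝ := fun a => codePoint a 1 - √(1 - q a ^ 2)
  -- The constant is `8 * 6` from the graph property of the dust plus `1` from the arc. It also
  -- makes `r` a function of `q`, which can be extended to the line as a Lipschitz function.
  have hr : ∀ a b, |r a - r b| ≤ 49 * |q a - q b| := by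
    intro a b
    have h1 := abs_sqrt_one_sub_sq_sub_le (hq a) (hq b)
    have h2 := (dist_le_pi_dist (codePoint a) (codePoint b) 1).trans (dist_codePoint_le a b)
    have h3 : (codePoint a 0 + 2 * codePoint a 1) - (codePoint b 0 + 2 * codePoint b 1) =
      6 * (q a - q b) := by simp only [q]; ring
    rw [h3, abs_mul, abs_of_nonneg (by norm_num : (0 : ℝ) ≤ 6), Real.dist_eq] at h2
    have h4 : r a - r b = (codePoint a 1 - codePoint b 1) - (√(1 - q a ^ 2) - √(1 - q b ^ 2)) := by
      simp only [r]; ring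
    rw [h4]
    linarith [abs_sub (codePoint a 1 - codePoint b 1) (√(1 - q a ^ 2) - √(1 - q b ^ 2))]
  let φ : ℝ → ℝ := fun x => if h : ∃ a, q a = x then r h.choose else 0
  have hφ : ∀ a, φ (q a) = r a := by
    intro a
    have h : ∃ b, q b = q a := ⟨a, rfl⟩
    simp only [φ, dif_pos h]
    have h1 := hr h.choose a
    rw [h.choose_spec, sub_self, abs_zero, mul_zero] at h1
    linarith [abs_eq_zero.1 (le_antisymm h1 (abs_nonneg _))]
  have hlip : LipschitzOnWith 49 φ (Set.range q) := by
    refine LipschitzOnWith.of_dist_le_mul ?_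
    rintro _ ⟨a, rfl⟩ _ ⟨b, rfl⟩
    rw [hφ, hφ, Real.dist_eq, Real.dist_eq]
    exact hr a b
  obtain ⟨Φ, hΦ, heq⟩ := hlip.extend_real
  refine ⟨Φ, 49, hΦ, fun a => ?_⟩
  have h1 : Φ (q a) = r a := by rw [← heq (Set.mem_range_self a), hφ]
  have h2 : (0 : ℝ) ≤ 1 - q a ^ 2 := by
    have := abs_le.1 (hq a)
    nlinarith
  change q a ^ 2 + (codePoint a 1 - Φ (q a)) ^ 2 = 1
  rw [h1, sub_sub_cancel, Real.sq_sqrt h2]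
  ring

/-- The shear `(x, y) ↦ (6 x - 2 (y + Φ x), y + Φ x)`. -/
noncomputable def shear (Φ : ℝ → ℝ) (hΦ : Continuous Φ) :
    EuclideanSpace ℝ (Fin 2) ≃ₜ SupPlane where
  toFun x := ![6 * x 0 - 2 * (x 1 + Φ (x 0)), x 1 + Φ (x 0)]
  invFun v := !₂[(v 0 + 2 * v 1) / 6, v 1 - Φ ((v 0 + 2 * v 1) / 6)]
  left_inv x := by
    ext i
    fin_cases i <;> simp
  right_inv v := by
    ext i
    fin_cases i
    · simp; ring
    · simp
  continuous_toFun := by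
    refine continuous_pi fun i => ?_
    fin_cases i <;> simp <;> fun_prop
  continuous_invFun := by
    refine (PiLp.continuous_toLp 2 _).comp (continuous_pi fun i => ?_)
    fin_cases i <;> simp <;> fun_prop

theorem dist_shear_le {Φ : ℝ → ℝ} {K : ℝ≥0} (hΦ : LipschitzWith K Φ)
    (x y : EuclideanSpace ℝ (Fin 2)) :
    dist (shear Φ hΦ.continuous x) (shear Φ hΦ.continuous y) ≤ (8 + 2 * K) * dist x y := by
  have h0 := abs_coord_sub_le_dist x y 0
  have h1 := abs_coord_sub_le_dist x y 1
  have h2 := hΦ.dist_le_mul (x 0) (y 0)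
  rw [Real.dist_eq, Real.dist_eq] at h2
  have hK : (0 : ℝ) ≤ K := K.coe_nonneg
  have h3 : |Φ (x 0) - Φ (y 0)| ≤ K * dist x y := h2.trans (by gcongr)
  have hd : 0 ≤ dist x y := dist_nonneg
  have hKd : 0 ≤ K * dist x y := by positivity
  rw [abs_le] at h0 h1 h3
  refine (dist_pi_le_iff (by positivity)).2 fun i => ?_
  rw [Real.dist_eq, abs_le]
  fin_cases i
  · change _ ≤ 6 * x 0 - 2 * (x 1 + Φ (x 0)) - (6 * y 0 - 2 * (y 1 + Φ (y 0))) ∧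
      6 * x 0 - 2 * (x 1 + Φ (x 0)) - (6 * y 0 - 2 * (y 1 + Φ (y 0))) ≤ _
    constructor <;> linarith
  · change _ ≤ x 1 + Φ (x 0) - (y 1 + Φ (y 0)) ∧ x 1 + Φ (x 0) - (y 1 + Φ (y 0)) ≤ _
    constructor <;> linarith

theorem dist_le_mul_dist_shear {Φ : ℝ → ℝ} {K : ℝ≥0} (hΦ : LipschitzWith K Φ)
    (x y : EuclideanSpace ℝ (Fin 2)) :
    dist x y ≤ (2 + K) * dist (shear Φ hΦ.continuous x) (shear Φ hΦ.continuous y) := by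
  have h0 := dist_le_pi_dist (shear Φ hΦ.continuous x) (shear Φ hΦ.continuous y) 0
  have h1 := dist_le_pi_dist (shear Φ hΦ.continuous x) (shear Φ hΦ.continuous y) 1
  set D := dist (shear Φ hΦ.continuous x) (shear Φ hΦ.continuous y)
  have hD : 0 ≤ D := dist_nonneg
  have h2 := hΦ.dist_le_mul (x 0) (y 0)
  rw [Real.dist_eq] at h0 h1 h2
  rw [Real.dist_eq] at h2
  change |6 * x 0 - 2 * (x 1 + Φ (x 0)) - (6 * y 0 - 2 * (y 1 + Φ (y 0)))| ≤ D at h0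
  change |x 1 + Φ (x 0) - (y 1 + Φ (y 0))| ≤ D at h1
  have hK : (0 : ℝ) ≤ K := K.coe_nonneg
  rw [abs_le] at h0 h1
  have hx0 : |x 0 - y 0| ≤ D / 2 := by rw [abs_le]; constructor <;> linarith
  have h3 : |Φ (x 0) - Φ (y 0)| ≤ K * (D / 2) := h2.trans (by gcongr)
  rw [abs_le] at h3
  have hx1 : |x 1 - y 1| ≤ (1 + K / 2) * D := by rw [abs_le]; constructor <;> linarith
  rw [EuclideanSpace.dist_eq, Fin.sum_univ_two, Real.dist_eq, Real.dist_eq]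
  refine Real.sqrt_le_iff.2 ⟨by positivity, ?_⟩
  have h4 := pow_le_pow_left₀ (abs_nonneg _) hx0 2
  have h5 := pow_le_pow_left₀ (abs_nonneg _) hx1 2
  have h6 : 0 ≤ K * D ^ 2 := by positivity
  have h7 : 0 ≤ (K : ℝ) ^ 2 * D ^ 2 := by positivity
  nlinarith [sq_nonneg D]

/-! ### Quasiconformality and assembly of the maps. -/

/-- A bi-Lipschitz homeomorphism is quasiconformal. -/
theorem isQuasiconformal_of_dist_le {n : ℕ}
    (g : EuclideanSpace ℝ (Fin n) ≃ₜ EuclideanSpace ℝ (Fin n)) {K K' : ℝ} (hK : 0 ≤ K)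
    (h : ∀ x y, dist (g x) (g y) ≤ K * dist x y)
    (h' : ∀ x y, dist x y ≤ K' * dist (g x) (g y)) : IsQuasiconformal g := by
  refine ⟨K * K', fun x => Eventually.of_forall fun r y z hy hz => ?_⟩
  calc dist (g y) (g x) ≤ K * dist y x := h y x
    _ = K * dist z x := by rw [hy, hz]
    _ ≤ K * (K' * dist (g z) (g x)) := by gcongr; exact h' z x
    _ = K * K' * dist (g z) (g x) := by ring

theorem mem_Icc_iff_norm_squareChart_symm_le (x : EuclideanSpace ℝ (Fin 2)) :
    (∀ i, x i ∈ Set.Icc (0 : ℝ) 1) ↔ ‖squareChart.symm x‖ ≤ 1 := by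
  rw [pi_norm_le_iff_of_nonneg zero_le_one]
  refine forall_congr' fun i => ?_
  rw [squareChart_symm_apply, Real.norm_eq_abs, abs_le, Set.mem_Icc]
  constructor <;> rintro ⟨h1, h2⟩ <;> constructor <;> linarith

theorem mainTheorem3 (p : ℝ) (hp : 1 < p) :
    ∃ f : EuclideanSpace ℝ (Fin 2) ≃ₜ EuclideanSpace ℝ (Fin 2),
      LocallyHolder f ∧
      MemSobolevOneLoc 2 f ∧
      0 < logHausdorffMeasure p (f '' Metric.sphere 0 1) ∧
      -- the structure of the map: `f = h ∘ g`
      ∃ (g h : EuclideanSpace ℝ (Fin 2) ≃ₜ EuclideanSpace ℝ (Fin 2))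
        (C : Set (EuclideanSpace ℝ (Fin 2))),
        (∀ x, f x = h (g x)) ∧
        IsQuasiconformal g ∧ LocallyHolder g ∧
        LocallyHolder h ∧ MemSobolevOneLoc 2 h ∧
        (∀ x, (¬ ∀ i, x i ∈ Set.Icc (0 : ℝ) 1) → h x = x) ∧
        IsCantorSet C ∧ (∀ x ∈ C, ∀ i, x i ∈ Set.Icc (0 : ℝ) 1) ∧
        C ⊆ g '' Metric.sphere 0 1 ∧
        logHausdorffMeasure p C = 0 ∧
        0 < logHausdorffMeasure p (h '' C) := by
  have hp0 : 0 < p := by linarith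
  obtain ⟨μ, hμ, hs, c, hc0, hc⟩ := exists_admissibleRatios hp
  obtain ⟨Φ, K, hΦ, hcirc⟩ := exists_shear
  have hK : (0 : ℝ) ≤ K := K.coe_nonneg
  set G := shear Φ hΦ.continuous with hG
  set H := limitHomeo hμ
  let g := G.trans squareChart
  let h := squareChart.symm.trans (H.trans squareChart)
  let f := g.trans h
  have hf : ∀ x, f x = squareChart (limitMap μ (G x)) := fun x => by
    change squareChart (H (squareChart.symm (squareChart (G x)))) = _
    rw [Homeomorph.symm_apply_apply]
    rfl
  have hG1 : ∀ x y, dist (G x) (G y) ≤ (8 + 2 * K) * dist x y := dist_shear_le hΦ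
  have hG2 : ∀ x y, dist x y ≤ (2 + K) * dist (G x) (G y) := dist_le_mul_dist_shear hΦ
  have hchart : LipschitzWith 1 squareChart := LipschitzWith.mk_one dist_squareChart_le
  have hg1 : ∀ x y, dist (g x) (g y) ≤ (8 + 2 * K) * dist x y := fun x y =>
    (dist_squareChart_le _ _).trans (hG1 x y)
  have hg2 : ∀ x y, dist x y ≤ ((2 + K) * 2) * dist (g x) (g y) := fun x y => by
    refine (hG2 x y).trans ?_
    rw [mul_assoc]
    exact mul_le_mul_of_nonneg_left (dist_le_two_mul_dist_squareChart _ _) (by positivity)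
  have hCg : squareChart '' cantorDust ⊆ g '' Metric.sphere 0 1 := by
    rintro _ ⟨_, ⟨a, rfl⟩, rfl⟩
    refine ⟨G.symm (codePoint a), ?_, ?_⟩
    · rw [mem_sphere_zero_iff_norm, EuclideanSpace.norm_eq, Fin.sum_univ_two, Real.norm_eq_abs,
        Real.norm_eq_abs, sq_abs, sq_abs, Real.sqrt_eq_one]
      exact hcirc a
    · change squareChart (G (G.symm (codePoint a))) = _
      rw [Homeomorph.apply_symm_apply]
  have hhC : h '' (squareChart '' cantorDust) = squareChart '' (limitMap μ '' cantorDust) := by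
    rw [Set.image_image, Set.image_image]
    refine Set.image_congr fun v _ => ?_
    change squareChart (H (squareChart.symm (squareChart v))) = _
    rw [Homeomorph.symm_apply_apply]
    rfl
  have hpos : 0 < logHausdorffMeasure p (h '' (squareChart '' cantorDust)) := by
    rw [hhC]; exact logHausdorffMeasure_image_pos hp0 hμ hc0 hc
  refine ⟨f, ?_, ?_, ?_, g, h, squareChart '' cantorDust, fun _ => rfl,
    isQuasiconformal_of_dist_le g (by positivity) hg1 hg2,
    (LipschitzWith.of_dist_le' hg1).locallyHolder, ?_, ?_, fun x hx => ?_,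
    isCantorSet_image_cantorDust squareChart, ?_, hCg, logHausdorffMeasure_cantorDust hp0, hpos⟩
  · rw [show (f : EuclideanSpace ℝ (Fin 2) → EuclideanSpace ℝ (Fin 2)) =
      squareChart ∘ limitMap μ ∘ G from funext hf]
    exact hchart.comp_locallyHolder
      ((locallyHolder_limitMap hμ).comp_lipschitzWith (LipschitzWith.of_dist_le' hG1))
  · rw [show (f : EuclideanSpace ℝ (Fin 2) → EuclideanSpace ℝ (Fin 2)) =
      fun x => squareChart (limitMap μ (G x)) from funext hf]
    exact memSobolevOneLoc_limitMap_comp hμ hs (by positivity) hG1 hG2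
  · refine hpos.trans_le (measure_mono ?_)
    rintro _ ⟨y, hy, rfl⟩
    obtain ⟨x, hx, rfl⟩ := hCg hy
    exact ⟨x, hx, rfl⟩
  · exact hchart.comp_locallyHolder
      ((locallyHolder_limitMap hμ).comp_lipschitzWith
        (LipschitzWith.of_dist_le' dist_squareChart_symm_le))
  · refine memSobolevOneLoc_limitMap_comp hμ hs zero_le_two dist_squareChart_symm_le
      (K' := 1) fun x y => ?_
    rw [one_mul]
    simpa using dist_squareChart_le (squareChart.symm x) (squareChart.symm y)
  · rw [mem_Icc_iff_norm_squareChart_symm_le, not_le] at hx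
    change squareChart (limitMap μ (squareChart.symm x)) = x
    rw [(unitBallMap_limitMap hμ).eq_self _ hx.le, Homeomorph.apply_symm_apply]
  · rintro _ ⟨_, ⟨a, rfl⟩, rfl⟩
    rw [mem_Icc_iff_norm_squareChart_symm_le, Homeomorph.symm_apply_apply]
    exact norm_codePoint_le a
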